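/- **Theorem.** There is an absolute constant $C>0$ such that for all integers $n\ge 1$, $t\ge 0$, every set $Q$ (the *quorum*) of exactly $3t+1$ of the $n$ parties, and every set $V$ of values, there is a deterministic protocol using a public-key infrastructure that solves asynchronous Quorum-to-All Broadcast from $Q$ in the presence of at most $t$ Byzantine faults, with communication complexity at most $C\,(n+t^2)\log n$; that is, $O((n+t^2)\log n)$. *The problem.* For an arbitrary $v_{in}\in V$, every honest party of $Q$ starts with input $v_{in}$ and every other honest party starts without input; all honest parties are given a predicate $\mathrm{verify}$ with $\mathrm{verify}(v)$ true if and only if $v=v_{in}$. Every honest party must eventually decide $v_{in}$ (and no party decides any other value while it is uncorrupted). *Model.* Parties are deterministic and event-driven and communicate over authenticated point-to-point channels in an asynchronous network: an adversary schedules the starts and deliveries, subject only to every honest party eventually starting and every message between honest parties eventually being delivered. The adversary sees all messages sent, knows all values, and adaptively corrupts at most $t$ parties, which then behave arbitrarily; a party is honest in an execution if it is never corrupted. Signatures are ideal (symbolic): each party has a signing key, and to each party belongs an aggregate signature scheme for a committee fixed by the protocol, in which one aggregate signature on a message can be combined exactly from the partial signatures on it of all committee members; nobody, honest or corrupted, can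 produce a signature of a party whose key they do not hold without having obtained it. Values are opaque to the protocol: a party can send or decide a value only if that value is its input or can be obtained from messages that it received. The communication complexity is the maximum, over all executions, of the total number of words sent by parties while uncorrupted, where a word holds a constant number of bits, values and signatures. -/

import Mathlib

universe u

namespace QAB

/-- Messages, as terms over ideal cryptography. The parties are `Fin n`, the values to be broadcast
come from `V`. The term `sig p m` is the signature of `m` under the key of `p`. To every party `r`
there belongs one aggregate signature scheme, whose participants form the committee of `r`;
`psig r p m` is the partial signature of the participant `p` on `m` in it, and `agg r m` is the
aggregate signature combined from the partial signatures on `m` of *all* its participants. The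
algebra is free: a signature is valid for `m` and `p` iff it is the term `sig p m`, an aggregate
signature is valid for `m` and `r` iff it is the term `agg r m`. -/
inductive Msg (n : ℕ) (V : Type u) : Type u
  | bit (b : Bool) : Msg n V
  | val (v : V) : Msg n V
  | pair (a b : Msg n V) : Msg n V
  | sig (p : Fin n) (m : Msg n V) : Msg n V
  | psig (r p : Fin n) (m : Msg n V) : Msg n V
  | agg (r : Fin n) (m : Msg n V) : Msg n V

/-- The number of words of a message. A word holds one bit, one value or one signature; a signature
is charged together with the message that it signs, so that nothing can be packed into it. -/
def Msg.words {n : ℕ} {V : Type u} : Msg n V → ℕ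
  | .bit _ => 1
  | .val _ => 1
  | .pair a b => a.words + b.words
  | .sig _ m => 1 + m.words
  | .psig _ _ m => 1 + m.words
  | .agg _ m => 1 + m.words

/-- `Derivable committee keys K m`: somebody who holds the signing keys of the parties in `keys` and
knows the messages in `K` can produce `m`. Neither a signature of somebody else nor a value can be
produced without having been obtained from somewhere. -/
inductive Derivable {n : ℕ} {V : Type u} (committee : Fin n → Finset (Fin n))
    (keys : Set (Fin n)) (K : Set (Msg n V)) : Msg n V → Prop
  | known (m : Msg n V) (h : m ∈ K) : Derivable committee keys K m
  | bit (b : Bool) : Derivable committee keys K (.bit b)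
  | pair (a b : Msg n V) (ha : Derivable committee keys K a) (hb : Derivable committee keys K b) :
      Derivable committee keys K (.pair a b)
  | fst (a b : Msg n V) (h : Derivable committee keys K (.pair a b)) : Derivable committee keys K a
  | snd (a b : Msg n V) (h : Derivable committee keys K (.pair a b)) : Derivable committee keys K b
  | sign (p : Fin n) (m : Msg n V) (hp : p ∈ keys) (h : Derivable committee keys K m) :
      Derivable committee keys K (.sig p m)
  | psign (r p : Fin n) (m : Msg n V) (hp : p ∈ keys) (hr : p ∈ committee r)
      (h : Derivable committee keys K m) : Derivable committee keys K (.psig r p m)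
  | combine (r : Fin n) (m : Msg n V) (hm : Derivable committee keys K m)
      (h : ∀ p ∈ committee r, Derivable committee keys K (.psig r p m)) :
      Derivable committee keys K (.agg r m)
  | openSig (p : Fin n) (m : Msg n V) (h : Derivable committee keys K (.sig p m)) :
      Derivable committee keys K m
  | openPsig (r p : Fin n) (m : Msg n V) (h : Derivable committee keys K (.psig r p m)) :
      Derivable committee keys K m
  | openAgg (r : Fin n) (m : Msg n V) (h : Derivable committee keys K (.agg r m)) :
      Derivable committee keys K m

/-- What happens at one party: it starts (a quorum node with its input value, any other party
without input), or it receives a message over the authenticated channel from `src`. -/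
inductive Event (n : ℕ) (V : Type u) : Type u
  | start (input : Option V) : Event n V
  | recv (src : Fin n) (m : Msg n V) : Event n V

/-- What a party knows after the events in `h`: its input and the messages that it received. -/
def viewKnowledge {n : ℕ} {V : Type u} (h : List (Event n V)) : Set (Msg n V) :=
  {m | (∃ v, Event.start (some v) ∈ h ∧ m = .val v) ∨ ∃ q, Event.recv q m ∈ h}

/-- A deterministic event-driven protocol with a PKI. A party acts on its local history, a list of
events with the most recent one first, and on the predicate `verify` that it is given.
`send p verify h` are the messages, with their recipients, that `p` sends in reaction to the first
event of `h`; `decision p verify h` is the value that `p` has decided after `h`, if any.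
A party can send and decide only what it can derive from its own key and its own history; in
particular it cannot use a value just because it satisfies `verify`. -/
structure Protocol (n : ℕ) (V : Type u) where
  committee : Fin n → Finset (Fin n)
  send : Fin n → (V → Bool) → List (Event n V) → List (Fin n × Msg n V)
  decision : Fin n → (V → Bool) → List (Event n V) → Option V
  send_derivable : ∀ p verify h x, x ∈ send p verify h →
    Derivable committee {p} (viewKnowledge h) x.2
  decision_derivable : ∀ p verify h v, decision p verify h = some v →
    Derivable committee {p} (viewKnowledge h) (.val v)

/-- A message in the network. -/
structure Packet (n : ℕ) (V : Type u) where
  src : Fin n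
  dst : Fin n
  msg : Msg n V

/-- A global state: the parties corrupted so far, the local histories (empty for a party that has
not started), the list of all messages sent so far by parties that were honest when sending, and the
positions in that list of the messages delivered so far. -/
structure Config (n : ℕ) (V : Type u) where
  corrupted : Finset (Fin n)
  view : Fin n → List (Event n V)
  sent : List (Packet n V)
  delivered : Finset ℕ

/-- The state before anything has happened. -/
def Config.initial (n : ℕ) (V : Type u) : Config n V where
  corrupted := ∅
  view := fun _ => []
  sent := []
  delivered := ∅

/-- The adversary knows all values and sees every message of an honest party as soon as it is
sent. -/
def Config.adversaryKnowledge {n : ℕ} {V : Type u} (c : Config n V) : Set (Msg n V) :=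
  {m | (∃ v, m = .val v) ∨ ∃ x ∈ c.sent, x.msg = m}

/-- The honest party `p` experiences the event `e` and reacts to it. -/
def Config.activate {n : ℕ} {V : Type u} (P : Protocol n V) (verify : V → Bool)
    (c : Config n V) (p : Fin n) (e : Event n V) : Config n V :=
  { c with
    view := Function.update c.view p (e :: c.view p)
    sent := c.sent ++ (P.send p verify (e :: c.view p)).map (fun x => ⟨p, x.1, x.2⟩) }

/-- The moves of the asynchronous adversary, who schedules everything and corrupts up to `t` parties
adaptively: do nothing, corrupt a party, start an honest party, deliver a message sent by an honest
party, let a corrupted party `p` deliver to an honest party `q` any message that the adversary can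
derive. -/
inductive Step {n : ℕ} {V : Type u} (P : Protocol n V) (Q : Finset (Fin n)) (t : ℕ) (vin : V)
    (verify : V → Bool) : Config n V → Config n V → Prop
  | idle (c : Config n V) : Step P Q t vin verify c c
  | corrupt (c : Config n V) (p : Fin n) (hp : p ∉ c.corrupted) (ht : c.corrupted.card < t) :
      Step P Q t vin verify c { c with corrupted := insert p c.corrupted }
  | startQuorum (c : Config n V) (p : Fin n) (hp : p ∉ c.corrupted) (h : c.view p = [])
      (hQ : p ∈ Q) :
      Step P Q t vin verify c (c.activate P verify p (.start (some vin)))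
  | startOther (c : Config n V) (p : Fin n) (hp : p ∉ c.corrupted) (h : c.view p = [])
      (hQ : p ∉ Q) :
      Step P Q t vin verify c (c.activate P verify p (.start none))
  | deliver (c : Config n V) (k : ℕ) (x : Packet n V) (hx : c.sent[k]? = some x)
      (hk : k ∉ c.delivered) (hdst : x.dst ∉ c.corrupted) (h : c.view x.dst ≠ []) :
      Step P Q t vin verify c
        ({ c with delivered := insert k c.delivered }.activate P verify x.dst (.recv x.src x.msg))
  | byzantine (c : Config n V) (p q : Fin n) (m : Msg n V) (hp : p ∈ c.corrupted)
      (hq : q ∉ c.corrupted) (h : c.view q ≠ [])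
      (hm : Derivable P.committee (c.corrupted : Set (Fin n)) c.adversaryKnowledge m) :
      Step P Q t vin verify c (c.activate P verify q (.recv p m))

/-- The honest parties of an execution are those that are never corrupted. -/
def Honest {n : ℕ} {V : Type u} (c : ℕ → Config n V) (p : Fin n) : Prop :=
  ∀ i, p ∉ (c i).corrupted

/-- An execution in an asynchronous network: every honest party eventually starts, and every message
from an honest party to an honest party is eventually delivered. -/
structure IsExecution {n : ℕ} {V : Type u} (P : Protocol n V) (Q : Finset (Fin n)) (t : ℕ) (vin : V)
    (verify : V → Bool) (c : ℕ → Config n V) : Prop where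
  initial : c 0 = Config.initial n V
  step : ∀ i, Step P Q t vin verify (c i) (c (i + 1))
  starts : ∀ p, Honest c p → ∃ i, (c i).view p ≠ []
  delivers : ∀ i k x, (c i).sent[k]? = some x → Honest c x.src → Honest c x.dst →
    ∃ j, k ∈ (c j).delivered

/-- The number of words sent by honest parties so far. -/
def Config.wordsSent {n : ℕ} {V : Type u} (c : Config n V) : ℕ :=
  (c.sent.map fun x => x.msg.words).sum

/-- `P` solves quorum-to-all broadcast from the quorum `Q` in asynchrony with up to `t` Byzantine
faults: for every common input `vin` of the quorum nodes and in every execution, every honest party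
eventually decides `vin`, and no party decides another value while it is not corrupted. -/
def Solves {n : ℕ} {V : Type u} (P : Protocol n V) (Q : Finset (Fin n)) (t : ℕ) : Prop :=
  ∀ (vin : V) (verify : V → Bool), (∀ v, verify v = true ↔ v = vin) →
    ∀ c : ℕ → Config n V, IsExecution P Q t vin verify c →
      (∀ p, Honest c p → ∃ i, P.decision p verify ((c i).view p) = some vin) ∧
      (∀ i p v, p ∉ (c i).corrupted → P.decision p verify ((c i).view p) = some v → v = vin)

/-- In every execution the honest parties send at most `B` words in total. -/
def CommunicationAtMost {n : ℕ} {V : Type u} (P : Protocol n V) (Q : Finset (Fin n)) (t : ℕ)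
    (B : ℝ) : Prop :=
  ∀ (vin : V) (verify : V → Bool), (∀ v, verify v = true ↔ v = vin) →
    ∀ c : ℕ → Config n V, IsExecution P Q t vin verify c → ∀ i, ((c i).wordsSent : ℝ) ≤ B

end QAB

/-! All parties are arranged in a binary heap. A party that has the value passes it to its two
children and sends each of its ancestors a partial signature for that ancestor's scheme. The
committee of `r` is the whole subtree of `r`, so the certificate `agg r ack` proves that every
uncorrupted party below `r` has the value. A subtree is released to the quorum only after roughly
`3t/2` quorum nodes have requested it. Requests carry the value. Each quorum node requests the root
and, on every level with at most `t` parties not covered by a certificate, the children of those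
parties. Quorum nodes forward certificates along a sparse expander.

Liveness: the honest quorum nodes contain a core `H` of more than `3t/2` nodes that is connected in
the expander (`IsExpander.exists_core`), so a certificate known to one core node reaches all of
them. By induction on the level, an honest subtree that stayed uncovered would be requested by all
of `H`, hence certified. Every uncovered party therefore has a corrupted descendant. Subtrees rooted
on the same level are disjoint, so at most `t` parties stay uncovered on each level
(`exists_card_pending_le`). An honest party without the value cannot be covered, as its partial
signature is missing (`learned_of_agg_mem`). Hence it is eventually requested, and the request gives
it the value.

Cost: with `L = Nat.log 2 n + 1`, the tree and the partial signatures account for `O(n L)` messages.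
Per level, the requests of a quorum node concern the children of at most `t` parties
(`exists_pending_cover`), giving `O(1 + t L)` requests. A release needs more than `t / 2` requests
from honest quorum nodes, so double counting yields `O(1 + t L)` releases (`card_releasers_mul_le`).
Only these certificates and those of at most `t` corrupted roots can exist, and the expander has
`O(t + 1)` edges, which gives `O((n + t^2) L)` words in all. -/

namespace QAB

open Finset

/-! ### The binary heap on the parties -/

/-- The depth of a party in the binary heap on the parties. -/
def level {n : ℕ} (p : Fin n) : ℕ := Nat.log 2 (p.val + 1)

/-- `r` is an ancestor of `p`, or `p` itself, in the binary heap on the parties. -/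
def Ancestor {n : ℕ} (r p : Fin n) : Prop := ∃ k, (p.val + 1) / 2 ^ k = r.val + 1

/-- `c` is a child of `r` in the binary heap on the parties. -/
def IsChild {n : ℕ} (r c : Fin n) : Prop := (c.val + 1) / 2 = r.val + 1

section Heap

variable {n : ℕ} {r p q a b c : Fin n}

theorem Ancestor.refl (p : Fin n) : Ancestor p p := ⟨0, by simp⟩

theorem IsChild.ancestor (h : IsChild r c) : Ancestor r c := ⟨1, by simpa [IsChild] using h⟩

theorem Ancestor.trans (h : Ancestor r p) (h' : Ancestor p q) : Ancestor r q := by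
  obtain ⟨k, hk⟩ := h
  obtain ⟨l, hl⟩ := h'
  exact ⟨l + k, by rw [pow_add, ← Nat.div_div_eq_div_mul, hl, hk]⟩

theorem IsChild.level_eq (h : IsChild r c) : level c = level r + 1 := by
  unfold IsChild at h
  unfold level
  rw [← h, Nat.log_div_base]
  have : 0 < Nat.log 2 (c.val + 1) := Nat.log_pos (by norm_num) (by omega)
  omega

theorem IsChild.lt (h : IsChild r c) : r < c := by
  unfold IsChild at h
  rw [Fin.lt_def]
  omega

theorem Ancestor.eq_or_exists_isChild (h : Ancestor r p) :
    r = p ∨ ∃ d, IsChild d p ∧ Ancestor r d := by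
  obtain ⟨k, hk⟩ := h
  cases k with
  | zero => left; ext; simpa using hk.symm
  | succ k =>
    right
    have hk' : (p.val + 1) / 2 / 2 ^ k = r.val + 1 := by
      rw [Nat.div_div_eq_div_mul, ← hk, pow_succ']
    have hpos : (p.val + 1) / 2 ≠ 0 := by
      intro h0
      simp [h0] at hk'
    refine ⟨⟨(p.val + 1) / 2 - 1, by have := p.2; omega⟩, ?_, k, ?_⟩
    · simp only [IsChild]; omega
    · simp only
      rw [Nat.sub_add_cancel (by omega), hk']

theorem exists_isChild (h : p.val ≠ 0) : ∃ d, IsChild d p :=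
  ⟨⟨(p.val + 1) / 2 - 1, by have := p.2; omega⟩, by simp only [IsChild]; omega⟩

/-- A step to the parent lowers the level by one, so the level of an ancestor fixes the number of
steps to it. This gives both the bound on the number of ancestors and the disjointness of subtrees
rooted on one level. -/
theorem Ancestor.eq_of_level_eq (ha : Ancestor a p) (hb : Ancestor b p)
    (h : level a = level b) : a = b := by
  obtain ⟨k, hk⟩ := ha
  obtain ⟨l, hl⟩ := hb
  have aux : ∀ (k : ℕ) (a : Fin n), (p.val + 1) / 2 ^ k = a.val + 1 →
      level a + k = Nat.log 2 (p.val + 1) := by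
    intro k a hk
    have hle : 2 ^ k ≤ p.val + 1 := by
      by_contra hlt
      rw [Nat.div_eq_of_lt (by omega)] at hk
      omega
    have : k ≤ Nat.log 2 (p.val + 1) := Nat.le_log_of_pow_le (by norm_num) hle
    unfold level
    rw [← hk, Nat.log_div_base_pow]
    omega
  have h1 := aux k a hk
  have h2 := aux l b hl
  have : k = l := by omega
  subst this
  ext
  omega

theorem level_lt (p : Fin n) : level p < Nat.log 2 n + 1 :=
  Nat.lt_succ_of_le (Nat.log_mono_right p.2)

open Classical in
theorem card_isChild_le (r : Fin n) : #{c | IsChild r c} ≤ 2 := by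
  have : (univ.filter (IsChild r)).image Fin.val ⊆ {2 * r.val + 1, 2 * r.val + 2} := by
    intro x hx
    simp only [mem_image, mem_filter, mem_univ, true_and, IsChild] at hx
    obtain ⟨c, hc, rfl⟩ := hx
    simp only [mem_insert, mem_singleton]
    omega
  calc #{c | IsChild r c} = #((univ.filter (IsChild r)).image Fin.val) :=
        (card_image_of_injective _ Fin.val_injective).symm
    _ ≤ _ := card_le_card this
    _ ≤ 2 := card_le_two

open Classical in
theorem card_ancestor_le (p : Fin n) : #{r | Ancestor r p} ≤ Nat.log 2 n + 1 := by
  have : #{r | Ancestor r p} ≤ #(range (Nat.log 2 n + 1)) := by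
    refine card_le_card_of_injOn level (fun r _ => ?_) ?_
    · exact mem_coe.2 (mem_range.2 (level_lt r))
    · intro a ha b hb h
      simp only [coe_filter, mem_univ, true_and, Set.mem_ofPred_eq] at ha hb
      exact ha.eq_of_level_eq hb h
  simpa using this

end Heap

/-! ### Expanders on the quorum and their connected cores -/

section Graph

variable {n : ℕ}

/-- The probabilistic method in counting form: among all families of 48 functions into `Q`, those
that avoid a fixed pair `(S, T)` are so rare that a union bound over at most `4 ^ m` pairs leaves a
good family. -/
theorem exists_expanding_functions (t : ℕ) (Q : Finset (Fin n)) (hQ : #Q = 3 * t + 1) :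
    ∃ f : Fin 48 × Fin n → Fin n, (∀ x, f x ∈ Q) ∧
      ∀ S ⊆ Q, ∀ T ⊆ Q, t < 2 * #S → t < 2 * #T → ∃ i, ∃ x ∈ S, f (i, x) ∈ T := by
  classical
  set m := #Q with hm
  let all : Finset (Fin 48 × Fin n → Fin n) := Fintype.piFinset fun _ => Q
  let bad : Finset (Fin n) × Finset (Fin n) → Finset (Fin 48 × Fin n → Fin n) :=
    fun ST => Fintype.piFinset fun x => if x.2 ∈ ST.1 then Q \ ST.2 else Q
  let pairs := (Q.powerset ×ˢ Q.powerset).filter fun ST => t < 2 * #ST.1 ∧ t < 2 * #ST.2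
  have hall : (#all : ℝ) = (m : ℝ) ^ (48 * n) := by
    simp [all, Fintype.card_piFinset, hm]
  have hmpos : (0 : ℝ) < m := by rw [hQ]; positivity
  have hbad : ∀ ST ∈ pairs, (#(bad ST) : ℝ) ≤ ((5 / 6 : ℝ) ^ 8) ^ m * #all := by
    rintro ⟨S, T⟩ hST
    simp only [pairs, mem_filter, mem_product, mem_powerset] at hST
    obtain ⟨⟨hS, hT⟩, hS2, hT2⟩ := hST
    have hcard : #(bad (S, T)) = (m - #T) ^ (48 * #S) * m ^ (48 * (n - #S)) := by
      simp only [bad, Fintype.card_piFinset]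
      rw [Fintype.prod_prod_type]
      have : ∀ x : Fin n, #(if x ∈ S then Q \ T else Q) = if x ∈ S then m - #T else m := by
        intro x
        split_ifs
        · rw [card_sdiff_of_subset hT]
        · rfl
      simp only [this, prod_ite, prod_const, card_univ, Fintype.card_fin]
      have h1 : #(univ.filter (· ∈ S)) = #S := by congr 1; ext; simp
      have h2 : #(univ.filter (· ∉ S)) = n - #S := by
        rw [filter_not, card_sdiff_of_subset (filter_subset _ _), h1]; simp
      rw [h1, h2, mul_pow, ← pow_mul, ← pow_mul, mul_comm 48, mul_comm 48]
    have hSn : #S ≤ n := by simpa using card_le_univ S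
    have hTm : #T ≤ m := card_le_card hT
    rw [hcard, hall]
    push_cast [Nat.cast_sub hTm]
    -- As `t + 1 ≤ 2 * #T` and `m = 3 * t + 1`, the set `T` fills at least a sixth of `Q`. The same
    -- bound for `S` turns the exponent `48 * #S` into at least `8 * m`.
    have hbase : (m : ℝ) - #T ≤ 5 / 6 * m := by
      have : (m : ℝ) ≤ 6 * #T := by
        have : m ≤ 6 * #T := by omega
        exact_mod_cast this
      linarith
    have h0 : (0 : ℝ) ≤ (m : ℝ) - #T := by
      have : (#T : ℝ) ≤ m := by exact_mod_cast hTm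
      linarith
    calc ((m : ℝ) - #T) ^ (48 * #S) * (m : ℝ) ^ (48 * (n - #S))
        ≤ (5 / 6 * (m : ℝ)) ^ (48 * #S) * (m : ℝ) ^ (48 * (n - #S)) := by gcongr
      _ = (5 / 6 : ℝ) ^ (48 * #S) * (m : ℝ) ^ (48 * n) := by
          rw [mul_pow, mul_assoc, ← pow_add]
          congr 3
          omega
      _ ≤ (5 / 6 : ℝ) ^ (8 * m) * (m : ℝ) ^ (48 * n) := by
          refine mul_le_mul_of_nonneg_right ?_ (by positivity)
          exact pow_le_pow_of_le_one (by norm_num) (by norm_num) (by omega)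
      _ = _ := by rw [pow_mul]
  have hpairs : (#pairs : ℝ) ≤ 4 ^ m := by
    have : #pairs ≤ 4 ^ m := by
      calc #pairs ≤ #(Q.powerset ×ˢ Q.powerset) := card_filter_le _ _
        _ = 4 ^ m := by
          rw [card_product, card_powerset, ← hm, ← mul_pow]; norm_num
    exact_mod_cast this
  have hallpos : (0 : ℝ) < #all := by rw [hall]; positivity
  have hlt : #(pairs.biUnion bad) < #all := by
    have : (#(pairs.biUnion bad) : ℝ) < #all := by
      calc (#(pairs.biUnion bad) : ℝ) ≤ ∑ ST ∈ pairs, (#(bad ST) : ℝ) := by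
            exact_mod_cast card_biUnion_le
        _ ≤ ∑ _ST ∈ pairs, ((5 / 6 : ℝ) ^ 8) ^ m * #all := sum_le_sum hbad
        _ = #pairs * (((5 / 6 : ℝ) ^ 8) ^ m * #all) := by rw [sum_const, nsmul_eq_mul]
        _ ≤ 4 ^ m * (((5 / 6 : ℝ) ^ 8) ^ m * #all) :=
            mul_le_mul_of_nonneg_right hpairs
              (mul_nonneg (pow_nonneg (pow_nonneg (by norm_num) _) _) hallpos.le)
        _ = (4 * (5 / 6 : ℝ) ^ 8) ^ m * #all := by rw [mul_pow]; ring
        _ < 1 * #all := by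
          refine mul_lt_mul_of_pos_right ?_ hallpos
          -- Here `4 * (5 / 6) ^ 8 < 1`, which is what 48 = 6 · 8 functions are chosen for.
          exact pow_lt_one₀ (by norm_num) (by norm_num) (by omega)
        _ = #all := one_mul _
    exact_mod_cast this
  obtain ⟨f, hf, hfb⟩ := exists_mem_notMem_of_card_lt_card hlt
  rw [Fintype.mem_piFinset] at hf
  refine ⟨f, hf, fun S hS T hT hS2 hT2 => ?_⟩
  by_contra hno
  push Not at hno
  refine hfb (mem_biUnion.2 ⟨(S, T), ?_, ?_⟩)
  · simp [pairs, hS, hT, hS2, hT2]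
  · rw [Fintype.mem_piFinset]
    rintro ⟨i, x⟩
    simp only
    split_ifs with hx
    · exact mem_sdiff.2 ⟨hf _, hno i x hx⟩
    · exact hf _

/-- A graph on the quorum `Q` with a linear number of edges in which any two sets of more than
`t / 2` quorum nodes are joined by an edge. -/
structure IsExpander (t : ℕ) (Q : Finset (Fin n)) (nbr : Fin n → Finset (Fin n)) : Prop where
  symm : ∀ x y, y ∈ nbr x → x ∈ nbr y
  sum_card_le : ∑ x ∈ Q, #(nbr x) ≤ 96 * (3 * t + 1)
  expands : ∀ S ⊆ Q, ∀ T ⊆ Q, t < 2 * #S → t < 2 * #T → ∃ x ∈ S, ∃ y ∈ T, y ∈ nbr x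

/-- The graphs of the 48 functions are made symmetric. Every edge then counts at both ends, whence
96 = 2 · 48. -/
theorem exists_isExpander (t : ℕ) (Q : Finset (Fin n)) (hQ : #Q = 3 * t + 1) :
    ∃ nbr, IsExpander t Q nbr := by
  classical
  obtain ⟨f, hfQ, hf⟩ := exists_expanding_functions t Q hQ
  let out : Fin n → Fin n → Prop := fun x y => x ∈ Q ∧ y ∈ Q ∧ ∃ i, f (i, x) = y
  refine ⟨fun x => {y | out x y ∨ out y x}, ⟨fun x y h => ?_, ?_, fun S hS T hT hS2 hT2 => ?_⟩⟩
  · simpa [or_comm] using h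
  · have hout : ∀ x, #{y | out x y} ≤ 48 := by
      intro x
      calc #{y | out x y} ≤ #(univ.image fun i : Fin 48 => f (i, x)) := by
            refine card_le_card fun y hy => ?_
            obtain ⟨-, -, i, hi⟩ := (mem_filter.1 hy).2
            exact mem_image.2 ⟨i, mem_univ _, hi⟩
        _ ≤ #(univ : Finset (Fin 48)) := card_image_le
        _ = 48 := by simp
    have hin : ∑ x ∈ Q, #{y | out y x} = ∑ y ∈ Q, #{x | out y x} := by
      have h := sum_card_bipartiteAbove_eq_sum_card_bipartiteBelow (s := Q) (t := Q)
        (fun x y => out y x)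
      have h1 : ∀ x, bipartiteAbove (fun x y => out y x) Q x = univ.filter fun y => out y x := by
        intro x; ext y; simp only [mem_bipartiteAbove, mem_filter, mem_univ, true_and, out]; tauto
      have h2 : ∀ y, bipartiteBelow (fun x y => out y x) Q y = univ.filter fun x => out y x := by
        intro x; ext y; simp only [mem_bipartiteBelow, mem_filter, mem_univ, true_and, out]; tauto
      simpa only [h1, h2] using h
    calc ∑ x ∈ Q, #{y | out x y ∨ out y x}
        ≤ ∑ x ∈ Q, (#{y | out x y} + #{y | out y x}) := by
          refine sum_le_sum fun x _ => ?_
          rw [filter_or]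
          exact card_union_le _ _
      _ = ∑ x ∈ Q, #{y | out x y} + ∑ x ∈ Q, #{y | out x y} := by rw [sum_add_distrib, hin]
      _ ≤ ∑ x ∈ Q, 48 + ∑ x ∈ Q, 48 := by gcongr <;> exact hout _
      _ = 96 * (3 * t + 1) := by rw [sum_const, hQ, smul_eq_mul]; ring
  · obtain ⟨i, x, hx, hxT⟩ := hf S hS T hT hS2 hT2
    exact ⟨x, hx, _, hxT, by simp [out, hS hx, hfQ]⟩

/-- `H` is a smallest set of more than `t / 2` nodes that is closed under adjacency inside `G`. No
edge leaves it within `G`, so expansion makes `G \ H` at most `t / 2` large. Minimality then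
prevents a closed `R` from splitting `H`. -/
theorem IsExpander.exists_core {t : ℕ} {Q : Finset (Fin n)} {nbr : Fin n → Finset (Fin n)}
    (hE : IsExpander t Q nbr) (G : Finset (Fin n)) (hG : G ⊆ Q) (hcard : 2 * t + 1 ≤ #G) :
    ∃ H ⊆ G, 3 * t + 2 ≤ 2 * #H ∧
      ∀ R : Set (Fin n), (∀ x ∈ R, x ∈ G → ∀ y ∈ nbr x, y ∈ G → y ∈ R) →
        (∃ x ∈ H, x ∈ R) → ∀ x ∈ H, x ∈ R := by
  classical
  let Closed : Finset (Fin n) → Prop := fun S => ∀ x ∈ S, ∀ y ∈ nbr x, y ∈ G → y ∈ S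
  let F := G.powerset.filter fun S => Closed S ∧ t < 2 * #S
  have hF : F.Nonempty := ⟨G, by
    simp only [F, mem_filter, mem_powerset, subset_rfl, true_and]
    exact ⟨fun x _ y _ hy => hy, by omega⟩⟩
  obtain ⟨H, hH, hmin⟩ := exists_min_image F card hF
  simp only [F, mem_filter, mem_powerset] at hH hmin
  obtain ⟨hHG, hHc, hHt⟩ := hH
  have hbig : 3 * t + 2 ≤ 2 * #H := by
    have h1 : 2 * #(G \ H) ≤ t := by
      by_contra hlt
      obtain ⟨x, hx, y, hy, hxy⟩ := hE.expands H (hHG.trans hG) (G \ H)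
        (sdiff_subset.trans hG) hHt (by omega)
      rw [mem_sdiff] at hy
      exact hy.2 (hHc x hx y hxy hy.1)
    have h2 := card_sdiff_add_card_eq_card hHG
    omega
  refine ⟨H, hHG, hbig, fun R hR ⟨x0, hx0, hx0R⟩ => ?_⟩
  have c1 : Closed (H.filter (· ∈ R)) := fun x hx y hy hyG => by
    rw [mem_filter] at hx ⊢
    exact ⟨hHc x hx.1 y hy hyG, hR x hx.2 (hHG hx.1) y hy hyG⟩
  have c2 : Closed (H.filter (· ∉ R)) := fun x hx y hy hyG => by
    rw [mem_filter] at hx ⊢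
    exact ⟨hHc x hx.1 y hy hyG, fun hyR => hx.2 (hR y hyR hyG x (hE.symm _ _ hy) (hHG hx.1))⟩
  have hsum := card_filter_add_card_filter_not (s := H) (· ∈ R)
  have hpos : 0 < #(H.filter (· ∈ R)) := card_pos.2 ⟨x0, mem_filter.2 ⟨hx0, hx0R⟩⟩
  -- Both parts of `H` are closed. If the part outside `R` is large, it contradicts minimality,
  -- since the other part is nonempty. Otherwise the part inside `R` is large, and minimality makes
  -- it all of `H`.
  by_cases h2 : t < 2 * #(H.filter (· ∉ R))
  · have := hmin _ ⟨(filter_subset _ _).trans hHG, c2, h2⟩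
    omega
  · have := hmin (H.filter (· ∈ R)) ⟨(filter_subset _ _).trans hHG, c1, by omega⟩
    have h0 : #(H.filter (· ∉ R)) = 0 := by omega
    intro x hx
    by_contra hxR
    have := card_eq_zero.1 h0 ▸ mem_filter.2 ⟨hx, hxR⟩
    simp at this

end Graph

/-! ### The protocol -/

section Protocol

variable {n : ℕ} {V : Type u}

/-- The content of acknowledgements. -/
def ack : Msg n V := .bit true

/-- The message by which a quorum node asks a party for the certificate of its subtree. -/
def request (v : V) : Msg n V := .pair (.val v) (.bit true)

/-- The value that an event conveys. -/
def Event.value? : Event n V → Option V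
  | .start input => input
  | .recv _ (.val v) => some v
  | .recv _ (.pair (.val v) _) => some v
  | _ => none

/-- A verified value in a local history. -/
def learned (verify : V → Bool) (h : List (Event n V)) : Option V :=
  h.findSome? fun e => e.value?.filter verify

theorem learned_spec {verify : V → Bool} {h : List (Event n V)} {v : V}
    (hv : learned verify h = some v) : verify v = true ∧ ∃ e ∈ h, e.value? = some v := by
  obtain ⟨e, he, hev⟩ := List.exists_of_findSome?_eq_some hv
  rw [Option.filter_eq_some_iff] at hev
  exact ⟨hev.2, e, he, hev.1⟩

theorem learned_isSome {verify : V → Bool} {h : List (Event n V)} {v : V} {e : Event n V}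
    (he : e ∈ h) (hev : e.value? = some v) (hv : verify v = true) :
    (learned verify h).isSome := by
  rw [learned, List.findSome?_isSome_iff]
  exact ⟨e, he, by simp [hev, hv]⟩

theorem derivable_of_learned {committee : Fin n → Finset (Fin n)} {keys : Set (Fin n)}
    {verify : V → Bool} {h : List (Event n V)} {v : V} (hv : learned verify h = some v) :
    Derivable committee keys (viewKnowledge h) (.val v) := by
  obtain ⟨-, e, he, hev⟩ := learned_spec hv
  unfold Event.value? at hev
  split at hev
  · subst hev
    exact .known _ (Or.inl ⟨v, he, rfl⟩)
  · cases hev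
    exact .known _ (Or.inr ⟨_, he⟩)
  · cases hev
    exact .fst _ _ (.known _ (Or.inr ⟨_, he⟩))
  · cases hev

open Classical in
/-- The parties of level `k` that are not covered by a certificate in `h`. -/
noncomputable def pending (k : ℕ) (h : List (Event n V)) : Finset (Fin n) :=
  {r | level r = k ∧ ∀ a, Ancestor a r → .agg a ack ∉ viewKnowledge h}

open Classical in
/-- The parties from whom a quorum node wants a certificate after `h`: the root, and the children of
the uncovered parties of each level on which at most `t` parties are uncovered. -/
noncomputable def requested (t : ℕ) (h : List (Event n V)) : Finset (Fin n) :=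
  {c | c.val = 0 ∨ ∃ r, IsChild r c ∧ r ∈ pending (level r) h ∧ #(pending (level r) h) ≤ t}

open Classical in
/-- The quorum nodes whose requests are in `h`. -/
noncomputable def requesters (Q : Finset (Fin n)) (v : V) (h : List (Event n V)) :
    Finset (Fin n) :=
  {q ∈ Q | .recv q (request v) ∈ h}

/-- After `h` the party `p` may release the certificate of its subtree: sufficiently many quorum
nodes asked for it, and it is complete. -/
def Released (t : ℕ) (Q : Finset (Fin n)) (v : V) (p : Fin n) (h : List (Event n V)) : Prop :=
  3 * t + 2 ≤ 2 * #(requesters Q v h) ∧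
    ∀ d, Ancestor p d → d ≠ p → .psig p d ack ∈ viewKnowledge h

open Classical in
/-- The parties whose certificates are in `h`. -/
noncomputable def certified (h : List (Event n V)) : Finset (Fin n) :=
  {r | .agg r ack ∈ viewKnowledge h}

open Classical in
/-- The messages that `p` should have sent when it has learned `v` and its history is `h`. -/
noncomputable def output (t : ℕ) (Q : Finset (Fin n)) (nbr : Fin n → Finset (Fin n)) (v : V)
    (p : Fin n) (h : List (Event n V)) : Finset (Fin n × Msg n V) :=
  ({c | IsChild p c} : Finset (Fin n)).image (fun c => (c, .val v)) ∪
  ({r | Ancestor r p ∧ r ≠ p} : Finset (Fin n)).image (fun r => (r, .psig r p ack)) ∪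
  (if Released t Q v p h then Q.image fun q => (q, .agg p ack) else ∅) ∪
  (if p ∈ Q then (requested t h).image (fun c => (c, request v)) else ∅) ∪
  (if p ∈ Q then (nbr p ×ˢ certified h).image (fun x => (x.1, .agg x.2 ack)) else ∅)

theorem mem_output {t : ℕ} {Q : Finset (Fin n)} {nbr : Fin n → Finset (Fin n)} {v : V}
    {p : Fin n} {h : List (Event n V)} {x : Fin n × Msg n V} :
    x ∈ output t Q nbr v p h ↔
      (IsChild p x.1 ∧ x.2 = .val v) ∨
      (Ancestor x.1 p ∧ x.1 ≠ p ∧ x.2 = .psig x.1 p ack) ∨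
      (Released t Q v p h ∧ x.1 ∈ Q ∧ x.2 = .agg p ack) ∨
      (p ∈ Q ∧ x.1 ∈ requested t h ∧ x.2 = request v) ∨
      (p ∈ Q ∧ x.1 ∈ nbr p ∧ ∃ r, .agg r ack ∈ viewKnowledge h ∧ x.2 = .agg r ack) := by
  obtain ⟨d, m⟩ := x
  have if_mem : ∀ (c : Prop) [Decidable c] (s : Finset (Fin n × Msg n V)) (y),
      y ∈ (if c then s else ∅) ↔ c ∧ y ∈ s := by
    intro c _ s y
    split_ifs with hc <;> simp [hc]
  simp only [output, mem_union, if_mem, mem_image, mem_filter, mem_univ, true_and, Prod.mk.injEq,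
    mem_product, Prod.exists, certified, or_assoc]
  constructor
  · rintro (⟨c, h1, rfl, rfl⟩ | ⟨c, ⟨h1, h2⟩, rfl, rfl⟩ | ⟨h1, q, h2, rfl, rfl⟩ |
      ⟨h1, q, h2, rfl, rfl⟩ | ⟨h1, q, r, ⟨h2, h3⟩, rfl, rfl⟩)
    · exact .inl ⟨h1, rfl⟩
    · exact .inr (.inl ⟨h1, h2, rfl⟩)
    · exact .inr (.inr (.inl ⟨h1, h2, rfl⟩))
    · exact .inr (.inr (.inr (.inl ⟨h1, h2, rfl⟩)))
    · exact .inr (.inr (.inr (.inr ⟨h1, h2, r, h3, rfl⟩)))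
  · rintro (⟨h1, rfl⟩ | ⟨h1, h2, rfl⟩ | ⟨h1, h2, rfl⟩ | ⟨h1, h2, rfl⟩ | ⟨h1, h2, r, h3, rfl⟩)
    · exact .inl ⟨_, h1, rfl, rfl⟩
    · exact .inr (.inl ⟨_, ⟨h1, h2⟩, rfl, rfl⟩)
    · exact .inr (.inr (.inl ⟨h1, _, h2, rfl, rfl⟩))
    · exact .inr (.inr (.inr (.inl ⟨h1, _, h2, rfl, rfl⟩)))
    · exact .inr (.inr (.inr (.inr ⟨h1, _, _, ⟨h2, h3⟩, rfl, rfl⟩)))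

/-- The messages that `p` should have sent when its history is `h`. A party that has not learned the
value sends nothing, and nobody sends anything if there is only one party. -/
noncomputable def reaction (t : ℕ) (Q : Finset (Fin n)) (nbr : Fin n → Finset (Fin n))
    (verify : V → Bool) (p : Fin n) (h : List (Event n V)) : Finset (Fin n × Msg n V) :=
  match learned verify h with
  | none => ∅
  | some v => if n = 1 then ∅ else output t Q nbr v p h

theorem mem_reaction {t : ℕ} {Q : Finset (Fin n)} {nbr : Fin n → Finset (Fin n)}
    {verify : V → Bool} {p : Fin n} {h : List (Event n V)} {x : Fin n × Msg n V} :
    x ∈ reaction t Q nbr verify p h ↔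
      n ≠ 1 ∧ ∃ v, learned verify h = some v ∧ x ∈ output t Q nbr v p h := by
  unfold reaction
  cases learned verify h <;> by_cases hn : n = 1 <;> simp [hn]

open Classical in
/-- The messages that `p` has sent in total when its history is `h`. -/
noncomputable def outputs (t : ℕ) (Q : Finset (Fin n)) (nbr : Fin n → Finset (Fin n))
    (verify : V → Bool) (p : Fin n) : List (Event n V) → Finset (Fin n × Msg n V)
  | [] => ∅
  | e :: h => outputs t Q nbr verify p h ∪ reaction t Q nbr verify p (e :: h)

theorem mem_outputs {t : ℕ} {Q : Finset (Fin n)} {nbr : Fin n → Finset (Fin n)}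
    {verify : V → Bool} {p : Fin n} {h : List (Event n V)} {x : Fin n × Msg n V} :
    x ∈ outputs t Q nbr verify p h ↔ ∃ h', h' <:+ h ∧ x ∈ reaction t Q nbr verify p h' := by
  induction h with
  | nil =>
    have : reaction t Q nbr verify p [] = ∅ := by simp [reaction, learned]
    simp [outputs, this]
  | cons e h ih =>
    simp only [outputs, mem_union, ih, List.suffix_cons_iff]
    constructor
    · rintro (⟨h', h1, h2⟩ | h1)
      · exact ⟨h', .inr h1, h2⟩
      · exact ⟨_, .inl rfl, h1⟩
    · rintro ⟨h', rfl | h1, h2⟩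
      · exact .inr h2
      · exact .inl ⟨h', h1, h2⟩

open Classical in
/-- The subtree of a party. -/
noncomputable def subtree (r : Fin n) : Finset (Fin n) := {p | Ancestor r p}

theorem mem_subtree {r p : Fin n} : p ∈ subtree r ↔ Ancestor r p := by simp [subtree]

theorem derivable_of_mem_reaction {t : ℕ} {Q : Finset (Fin n)} {nbr : Fin n → Finset (Fin n)}
    {verify : V → Bool} {p : Fin n} {h : List (Event n V)} {x : Fin n × Msg n V}
    (hx : x ∈ reaction t Q nbr verify p h) :
    Derivable subtree {p} (viewKnowledge h) x.2 := by
  obtain ⟨-, v, hv, hx⟩ := mem_reaction.1 hx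
  have hval : Derivable subtree {p} (viewKnowledge h) (.val v) := derivable_of_learned hv
  rcases mem_output.1 hx with ⟨-, h2⟩ | ⟨h1, -, h2⟩ | ⟨h1, -, h2⟩ | ⟨-, -, h2⟩ |
    ⟨-, -, r, h1, h2⟩ <;> rw [h2]
  · exact hval
  · exact .psign _ _ _ rfl (mem_subtree.2 h1) (.bit _)
  · refine .combine _ _ (.bit _) fun d hd => ?_
    -- The root never sends its own partial signature and supplies it only here, when it combines
    -- the certificate. This lets it withhold the certificate until enough requests have arrived.
    by_cases hdp : d = p
    · subst hdp
      exact .psign _ _ _ rfl hd (.bit _)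
    · exact .known _ (h1.2 d (mem_subtree.1 hd) hdp)
  · exact .pair _ _ hval (.bit _)
  · exact .known _ h1

open Classical in
/-- The broadcast protocol. -/
noncomputable def broadcast (V : Type u) (t : ℕ) (Q : Finset (Fin n))
    (nbr : Fin n → Finset (Fin n)) : Protocol n V where
  committee := subtree
  -- Only what is new compared with the preceding history is sent, so no party sends the same
  -- message twice to the same recipient.
  send p verify h :=
    (outputs t Q nbr verify p h \ outputs t Q nbr verify p h.tail).toList
  decision _ verify h := learned verify h
  send_derivable p verify h x hx := by
    rw [mem_toList, mem_sdiff] at hx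
    cases h with
    | nil => simp [outputs] at hx
    | cons e h =>
      rw [outputs, mem_union, List.tail_cons] at hx
      exact derivable_of_mem_reaction (hx.1.resolve_left hx.2)
  decision_derivable _ _ _ _ hv := derivable_of_learned hv

end Protocol

/-! ### General facts on executions, and unforgeability -/

section Executions

variable {n : ℕ} {V : Type u}

/-- A move either leaves histories and network alone, or is an event at an uncorrupted party. -/
theorem Step.quiet_or_activate {P : Protocol n V} {Q : Finset (Fin n)} {t : ℕ} {vin : V}
    {verify : V → Bool} {c c' : Config n V} (h : Step P Q t vin verify c c') :
    (c'.view = c.view ∧ c'.sent = c.sent ∧ c'.delivered = c.delivered ∧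
      c.corrupted ⊆ c'.corrupted ∧ (#c.corrupted ≤ t → #c'.corrupted ≤ t)) ∨
    ∃ p e, p ∉ c.corrupted ∧ c'.corrupted = c.corrupted ∧
      c'.view = Function.update c.view p (e :: c.view p) ∧
      c'.sent = c.sent ++ (P.send p verify (e :: c.view p)).map (fun x => ⟨p, x.1, x.2⟩) ∧
      ((c'.delivered = c.delivered ∧ c.view p = [] ∧
          ∃ w, e = .start w ∧ (p ∈ Q → w = some vin)) ∨
       (c'.delivered = c.delivered ∧ c.view p ≠ [] ∧ ∃ q m, e = .recv q m ∧ q ∈ c.corrupted ∧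
          Derivable P.committee (c.corrupted : Set (Fin n)) c.adversaryKnowledge m) ∨
       (c.view p ≠ [] ∧ ∃ k x, c'.delivered = insert k c.delivered ∧ c.sent[k]? = some x ∧
          x.dst = p ∧ e = .recv x.src x.msg)) := by
  cases h with
  | idle => exact .inl ⟨rfl, rfl, rfl, subset_rfl, id⟩
  | corrupt p hp ht =>
    refine .inl ⟨rfl, rfl, rfl, subset_insert _ _, fun _ => ?_⟩
    rw [card_insert_of_notMem hp]
    exact ht
  | startQuorum p hp h hQ =>
    exact .inr ⟨p, _, hp, rfl, rfl, rfl, .inl ⟨rfl, h, _, rfl, fun _ => rfl⟩⟩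
  | startOther p hp h hQ =>
    exact .inr ⟨p, _, hp, rfl, rfl, rfl, .inl ⟨rfl, h, _, rfl, fun h => absurd h hQ⟩⟩
  | deliver k x hx hk hdst h =>
    exact .inr ⟨x.dst, _, hdst, rfl, rfl, rfl, .inr (.inr ⟨h, k, x, rfl, hx, rfl, rfl⟩)⟩
  | byzantine p q m hp hq h hm =>
    exact .inr ⟨q, _, hq, rfl, rfl, rfl, .inr (.inl ⟨rfl, h, p, m, rfl, hp, hm⟩)⟩

namespace IsExecution

variable {P : Protocol n V} {Q : Finset (Fin n)} {t : ℕ} {vin : V} {verify : V → Bool}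
  {c : ℕ → Config n V}

theorem corrupted_mono (E : IsExecution P Q t vin verify c) :
    Monotone fun i => (c i).corrupted := by
  refine monotone_nat_of_le_succ fun i => ?_
  rcases (E.step i).quiet_or_activate with ⟨-, -, -, h, -⟩ | ⟨p, e, -, h, -⟩
  · exact h
  · exact h.ge

theorem card_corrupted_le (E : IsExecution P Q t vin verify c) (i : ℕ) :
    #(c i).corrupted ≤ t := by
  induction i with
  | zero => simp [E.initial, Config.initial]
  | succ i ih =>
    rcases (E.step i).quiet_or_activate with ⟨-, -, -, -, h⟩ | ⟨p, e, -, h, -⟩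
    · exact h ih
    · rwa [h]

-- Dishonest parties may be corrupted at different times, but corruptions persist and there are
-- finitely many parties, so at one common time all of them are corrupted.
open Classical in
theorem card_not_honest_le (E : IsExecution P Q t vin verify c) :
    #{p | ¬ Honest c p} ≤ t := by
  have h : ∀ p, ∃ i, ¬ Honest c p → p ∈ (c i).corrupted := by
    intro p
    by_cases hp : Honest c p
    · exact ⟨0, fun h => absurd hp h⟩
    · simp only [Honest, not_forall, not_not] at hp
      obtain ⟨i, hi⟩ := hp
      exact ⟨i, fun _ => hi⟩
  choose f hf using h
  refine (card_le_card fun p hp => ?_).trans (E.card_corrupted_le (univ.sup f))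
  exact E.corrupted_mono (le_sup (mem_univ p)) (hf p (mem_filter.1 hp).2)

theorem view_suffix (E : IsExecution P Q t vin verify c) {i j : ℕ} (hij : i ≤ j) (p : Fin n) :
    (c i).view p <:+ (c j).view p := by
  induction j, hij using Nat.le_induction with
  | base => exact List.suffix_rfl
  | succ j _ ih =>
    refine ih.trans ?_
    rcases (E.step j).quiet_or_activate with ⟨h, -⟩ | ⟨q, e, -, -, h, -⟩ <;> rw [h]
    by_cases hpq : p = q
    · subst hpq
      simp
    · rw [Function.update_of_ne hpq]

theorem mem_view_of_le (E : IsExecution P Q t vin verify c) {i j : ℕ} (hij : i ≤ j) {p : Fin n}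
    {e : Event n V} (h : e ∈ (c i).view p) : e ∈ (c j).view p :=
  (E.view_suffix hij p).mem h

theorem start_mem_view (E : IsExecution P Q t vin verify c) {p : Fin n} (hp : p ∈ Q) (i : ℕ)
    (h : (c i).view p ≠ []) : .start (some vin) ∈ (c i).view p := by
  induction i with
  | zero => simp [E.initial, Config.initial] at h
  | succ i ih =>
    by_cases hi : (c i).view p = []
    · rcases (E.step i).quiet_or_activate with ⟨h', -⟩ | ⟨q, e, -, -, h', -, h''⟩
      · rw [h'] at h
        exact absurd hi h
      · rw [h'] at h ⊢
        by_cases hpq : p = q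
        · subst hpq
          rw [Function.update_self]
          rcases h'' with ⟨-, -, w, rfl, hw⟩ | ⟨-, h3, -⟩ | ⟨h3, -⟩
          · simp [hw hp]
          · exact absurd hi h3
          · exact absurd hi h3
        · rw [Function.update_of_ne hpq] at h
          exact absurd hi h
    · exact E.mem_view_of_le i.le_succ (ih hi)

theorem recv_mem_view (E : IsExecution P Q t vin verify c) {p q : Fin n} {m : Msg n V} {i : ℕ}
    (h : .recv q m ∈ (c i).view p) : ⟨q, p, m⟩ ∈ (c i).sent ∨ q ∈ (c i).corrupted := by
  induction i with
  | zero => simp [E.initial, Config.initial] at h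
  | succ i ih =>
    rcases (E.step i).quiet_or_activate with ⟨h1, h2, -, h3, -⟩ | ⟨r, e, -, h1, h2, h3, h4⟩
    · rw [h1] at h
      rw [h2]
      exact (ih h).imp_right fun h => h3 h
    · rw [h1, h3]
      suffices ⟨q, p, m⟩ ∈ (c i).sent ∨ q ∈ (c i).corrupted from
        this.imp_left fun h => List.mem_append_left _ h
      rw [h2] at h
      by_cases hpr : p = r
      · subst hpr
        rw [Function.update_self, List.mem_cons] at h
        rcases h with h | h
        · rcases h4 with ⟨-, -, w, rfl, -⟩ | ⟨-, -, q', m', rfl, hq, -⟩ |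
            ⟨-, k, x, -, hx, hd, rfl⟩
          · cases h
          · cases h
            exact .inr hq
          · cases h
            left
            subst hd
            exact List.mem_of_getElem? hx
        · exact ih h
      · rw [Function.update_of_ne hpr] at h
        exact ih h

theorem sent_getElem?_of_le (E : IsExecution P Q t vin verify c) {i j k : ℕ} {x : Packet n V}
    (hij : i ≤ j) (h : (c i).sent[k]? = some x) : (c j).sent[k]? = some x := by
  induction j, hij using Nat.le_induction with
  | base => exact h
  | succ j _ ih =>
    rcases (E.step j).quiet_or_activate with ⟨-, h2, -⟩ | ⟨q, e, -, -, -, h2, -⟩ <;> rw [h2]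
    · exact ih
    · rw [List.getElem?_append_left (List.getElem?_eq_some_iff.1 ih).1]
      exact ih

theorem delivered_spec (E : IsExecution P Q t vin verify c) {k i : ℕ}
    (h : k ∈ (c i).delivered) :
    ∃ x, (c i).sent[k]? = some x ∧ .recv x.src x.msg ∈ (c i).view x.dst := by
  induction i with
  | zero => simp [E.initial, Config.initial] at h
  | succ i ih =>
    have old : k ∈ (c i).delivered → ∃ x, (c (i + 1)).sent[k]? = some x ∧
        .recv x.src x.msg ∈ (c (i + 1)).view x.dst := by
      intro hk
      obtain ⟨x, hx, hv⟩ := ih hk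
      exact ⟨x, E.sent_getElem?_of_le i.le_succ hx, E.mem_view_of_le i.le_succ hv⟩
    rcases (E.step i).quiet_or_activate with ⟨-, -, h2, -⟩ | ⟨r, e, -, -, h2, h3, h4⟩
    · exact old (h2 ▸ h)
    · rcases h4 with ⟨h4, -⟩ | ⟨h4, -⟩ | ⟨-, l, x, h4, hx, hd, rfl⟩
      · exact old (h4 ▸ h)
      · exact old (h4 ▸ h)
      · rw [h4, mem_insert] at h
        rcases h with rfl | h
        · refine ⟨x, E.sent_getElem?_of_le i.le_succ hx, ?_⟩
          rw [h2, hd, Function.update_self]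
          exact List.mem_cons_self
        · exact old h

theorem exists_recv (E : IsExecution P Q t vin verify c) {p q : Fin n} {m : Msg n V} {i : ℕ}
    (h : ⟨p, q, m⟩ ∈ (c i).sent) (hp : Honest c p) (hq : Honest c q) :
    ∃ j, .recv p m ∈ (c j).view q := by
  obtain ⟨k, hk⟩ := List.mem_iff_getElem?.1 h
  obtain ⟨j, hj⟩ := E.delivers i k _ hk hp hq
  obtain ⟨x, hx, hv⟩ := E.delivered_spec hj
  -- The list of sent messages only grows at its end, so a position always denotes the same packet.
  have hx' : x = ⟨p, q, m⟩ := by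
    have h1 : (c (max i j)).sent[k]? = some x :=
      E.sent_getElem?_of_le (le_max_right i j) hx
    have h2 : (c (max i j)).sent[k]? = some ⟨p, q, m⟩ :=
      E.sent_getElem?_of_le (le_max_left i j) hk
    exact Option.some_injective _ (h1.symm.trans h2)
  subst hx'
  exact ⟨j, hv⟩

end IsExecution

/-- The message `m` contains neither a partial signature of `p` in the scheme of `r` nor an
aggregate signature in that scheme. -/
def Clean (r p : Fin n) : Msg n V → Prop
  | .bit _ => True
  | .val _ => True
  | .pair a b => Clean r p a ∧ Clean r p b
  | .sig _ m => Clean r p m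
  | .psig r' p' m => ¬ (r' = r ∧ p' = p) ∧ Clean r p m
  | .agg r' m => r' ≠ r ∧ Clean r p m

/-- Aggregation needs the partial signatures of the whole committee, including that of `p`, which is
excluded by induction. Since signatures can be opened, `Clean` has to inspect all subterms to be
preserved by every rule. -/
theorem Derivable.clean {committee : Fin n → Finset (Fin n)} {keys : Set (Fin n)}
    {K : Set (Msg n V)} {r p : Fin n} {m : Msg n V} (h : Derivable committee keys K m)
    (hp : p ∈ committee r) (hkey : p ∉ keys) (hK : ∀ m ∈ K, Clean r p m) : Clean r p m := by
  induction h with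
  | known m h => exact hK m h
  | bit => trivial
  | pair a b _ _ iha ihb => exact ⟨iha, ihb⟩
  | fst a b _ ih => exact ih.1
  | snd a b _ ih => exact ih.2
  | sign _ _ _ _ ih => exact ih
  | psign r' p' m hp' _ _ ih =>
    refine ⟨?_, ih⟩
    rintro ⟨-, rfl⟩
    exact hkey hp'
  | combine r' m _ _ ihm ih =>
    refine ⟨?_, ihm⟩
    rintro rfl
    exact (ih p hp).1 ⟨rfl, rfl⟩
  | openSig _ _ _ ih => exact ih
  | openPsig _ _ _ _ ih => exact ih.2
  | openAgg _ _ _ ih => exact ih.2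

/-- Unforgeability: as long as `p` is uncorrupted and has not been triggered to sign in the scheme
of `r`, no message in the system contains a partial signature of `p` in that scheme or an aggregate
signature in it. -/
theorem IsExecution.clean {P : Protocol n V} {Q : Finset (Fin n)} {t : ℕ} {vin : V}
    {verify : V → Bool} {c : ℕ → Config n V} (E : IsExecution P Q t vin verify c) {r p : Fin n}
    (hp : p ∈ P.committee r) (Trigger : List (Event n V) → Prop)
    (hmono : ∀ e h, Trigger h → Trigger (e :: h))
    (hsend : ∀ h, (∀ m ∈ viewKnowledge h, Clean r p m) → ¬ Trigger h →
      ∀ x ∈ P.send p verify h, Clean r p x.2)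
    {i : ℕ} (hc : p ∉ (c i).corrupted) (ht : ¬ Trigger ((c i).view p)) :
    (∀ x ∈ (c i).sent, Clean r p x.msg) ∧
      ∀ q, ∀ m ∈ viewKnowledge ((c i).view q), Clean r p m := by
  induction i with
  | zero => simp [E.initial, Config.initial, viewKnowledge]
  | succ i ih =>
    rcases (E.step i).quiet_or_activate with ⟨h1, h2, -, h3, -⟩ | ⟨a, e, -, h1, h2, h3, h4⟩
    · rw [h1] at ht ⊢
      rw [h2]
      exact ih (fun h => hc (h3 h)) ht
    · rw [h1] at hc
      have ht' : ¬ Trigger ((c i).view p) := by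
        rw [h2] at ht
        by_cases hpa : p = a
        · subst hpa
          rw [Function.update_self] at ht
          exact fun h => ht (hmono _ _ h)
        · rwa [Function.update_of_ne hpa] at ht
      obtain ⟨ih1, ih2⟩ := ih hc ht'
      have hnew : ∀ m ∈ viewKnowledge (e :: (c i).view a), Clean r p m := by
        rintro m (⟨v, -, rfl⟩ | ⟨q, hq⟩)
        · trivial
        · rw [List.mem_cons] at hq
          rcases hq with hq | hq
          · rcases h4 with ⟨-, -, w, rfl, -⟩ | ⟨-, -, q', m', rfl, -, hm⟩ |
              ⟨-, k, x, -, hx, hd, rfl⟩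
            · cases hq
            · cases hq
              refine hm.clean hp (by simpa using hc) ?_
              rintro m (⟨v, rfl⟩ | ⟨x, hx, rfl⟩)
              · trivial
              · exact ih1 x hx
            · cases hq
              exact ih1 x (List.mem_of_getElem? hx)
          · exact ih2 a m (.inr ⟨q, hq⟩)
      constructor
      · intro x hx
        rw [h3, List.mem_append, List.mem_map] at hx
        rcases hx with hx | ⟨y, hy, rfl⟩
        · exact ih1 x hx
        · by_cases hpa : p = a
          · subst hpa
            rw [h2, Function.update_self] at ht
            exact hsend _ hnew ht y hy
          -- A party other than `p` lacks the key of `p`, so derivability alone keeps its messages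
          -- clean, whatever the protocol.
          · exact (P.send_derivable _ _ _ _ hy).clean hp (by simpa using hpa) hnew
      · intro q m hm
        rw [h2] at hm
        by_cases hqa : q = a
        · subst hqa
          rw [Function.update_self] at hm
          exact hnew m hm
        · rw [Function.update_of_ne hqa] at hm
          exact ih2 q m hm

end Executions

/-! ### Sent messages in terms of local histories -/

section Broadcast

variable {n : ℕ} {V : Type u} {Q : Finset (Fin n)} {t : ℕ} {nbr : Fin n → Finset (Fin n)}
  {vin : V} {verify : V → Bool} {c : ℕ → Config n V}

theorem mem_broadcast_send {p : Fin n} {e : Event n V} {h : List (Event n V)}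
    {x : Fin n × Msg n V} : x ∈ (broadcast V t Q nbr).send p verify (e :: h) ↔
      x ∈ outputs t Q nbr verify p (e :: h) ∧ x ∉ outputs t Q nbr verify p h := by
  simp [broadcast]

theorem outputs_mono {p : Fin n} {h h' : List (Event n V)} (hs : h <:+ h') :
    outputs t Q nbr verify p h ⊆ outputs t Q nbr verify p h' := by
  intro x hx
  obtain ⟨g, hg, hx⟩ := mem_outputs.1 hx
  exact mem_outputs.2 ⟨g, hg.trans hs, hx⟩

/-- Events occur only at uncorrupted parties, so a history freezes upon corruption. The equivalence
therefore holds for corrupted parties as well. -/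
theorem mem_sent_iff (E : IsExecution (broadcast V t Q nbr) Q t vin verify c) {i : ℕ}
    {p q : Fin n} {m : Msg n V} :
    ⟨p, q, m⟩ ∈ (c i).sent ↔ (q, m) ∈ outputs t Q nbr verify p ((c i).view p) := by
  induction i with
  | zero => simp [E.initial, Config.initial, outputs]
  | succ i ih =>
    rcases (E.step i).quiet_or_activate with ⟨h1, h2, -⟩ | ⟨a, e, -, -, h2, h3, -⟩
    · rw [h1, h2, ih]
    · rw [h2, h3, List.mem_append, ih, List.mem_map]
      by_cases hpa : p = a
      · subst hpa
        rw [Function.update_self]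
        constructor
        · rintro (h | ⟨⟨q', m'⟩, h, heq⟩)
          · exact outputs_mono (List.suffix_cons _ _) h
          · cases heq
            exact (mem_broadcast_send.1 h).1
        · intro h
          by_cases h' : (q, m) ∈ outputs t Q nbr verify p ((c i).view p)
          · exact .inl h'
          · exact .inr ⟨(q, m), mem_broadcast_send.2 ⟨h, h'⟩, rfl⟩
      · rw [Function.update_of_ne hpa]
        constructor
        · rintro (h | ⟨y, -, heq⟩)
          · exact h
          · cases heq
            exact absurd rfl hpa
        · exact .inl

theorem wordsSent_eq (E : IsExecution (broadcast V t Q nbr) Q t vin verify c) (i : ℕ) :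
    (c i).wordsSent = ∑ p, ∑ x ∈ outputs t Q nbr verify p ((c i).view p), x.2.words := by
  classical
  induction i with
  | zero => simp [E.initial, Config.initial, outputs, Config.wordsSent]
  | succ i ih =>
    unfold Config.wordsSent at ih ⊢
    rcases (E.step i).quiet_or_activate with ⟨h1, h2, -⟩ | ⟨a, e, -, -, h2, h3, -⟩
    · rw [h1, h2, ih]
    · rw [h2, h3, List.map_append, List.sum_append, ih, List.map_map,
        ← add_sum_erase univ _ (mem_univ a), ← add_sum_erase univ _ (mem_univ a),
        Function.update_self]
      have h4 : ∑ p ∈ univ.erase a, ∑ x ∈ outputs t Q nbr verify p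
            (Function.update (c i).view a (e :: (c i).view a) p), x.2.words =
          ∑ p ∈ univ.erase a, ∑ x ∈ outputs t Q nbr verify p ((c i).view p), x.2.words :=
        sum_congr rfl fun p hp => by rw [Function.update_of_ne (ne_of_mem_erase hp)]
      have h5 : ((broadcast V t Q nbr).send a verify (e :: (c i).view a)).map
          ((fun x : Packet n V => x.msg.words) ∘ fun x => ⟨a, x.1, x.2⟩) =
          ((broadcast V t Q nbr).send a verify (e :: (c i).view a)).map fun x => x.2.words := rfl
      have h6 : (((broadcast V t Q nbr).send a verify (e :: (c i).view a)).map
          fun x => x.2.words).sum = ∑ x ∈ outputs t Q nbr verify a (e :: (c i).view a) \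
            outputs t Q nbr verify a ((c i).view a), x.2.words := by
        simp only [broadcast, List.tail_cons, sum_map_toList]
      rw [h4, h5, h6,
        ← sum_sdiff (outputs_mono (p := a) (t := t) (Q := Q) (nbr := nbr) (verify := verify)
          (List.suffix_cons e ((c i).view a)))]
      ring

end Broadcast

/-! ### Counting the messages of one party -/

section Histories

variable {n : ℕ} {V : Type u} {Q : Finset (Fin n)} {t : ℕ} {nbr : Fin n → Finset (Fin n)}
  {vin : V} {verify : V → Bool} {p : Fin n} {h h' : List (Event n V)} {x : Fin n × Msg n V}

theorem viewKnowledge_mono (hs : h <:+ h') : viewKnowledge h ⊆ viewKnowledge h' := by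
  rintro m (⟨v, hv, rfl⟩ | ⟨q, hq⟩)
  · exact .inl ⟨v, hs.mem hv, rfl⟩
  · exact .inr ⟨q, hs.mem hq⟩

theorem Released.mono (hs : h <:+ h') (hr : Released t Q vin p h) : Released t Q vin p h' := by
  refine ⟨hr.1.trans (Nat.mul_le_mul_left _ (card_le_card fun q hq => ?_)), fun d h1 h2 =>
    viewKnowledge_mono hs (hr.2 d h1 h2)⟩
  simp only [requesters, mem_filter] at hq ⊢
  exact ⟨hq.1, hs.mem hq.2⟩

theorem pending_antitone (hs : h <:+ h') (k : ℕ) : pending k h' ⊆ pending k h := by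
  intro r hr
  simp only [pending, mem_filter, mem_univ, true_and] at hr ⊢
  exact ⟨hr.1, fun a ha hk => hr.2 a ha (viewKnowledge_mono hs hk)⟩

theorem certified_mono (hs : h <:+ h') : certified h ⊆ certified h' := by
  intro r hr
  simp only [certified, mem_filter, mem_univ, true_and] at hr ⊢
  exact viewKnowledge_mono hs hr

/-- Pending sets shrink over time, so the first one with at most `t` elements contains all later
ones and can serve as `W`; if there is none, `W` is empty. Thus the requests made over a whole
execution are bounded, although the pending set changes. -/
theorem exists_pending_cover (t k : ℕ) (h : List (Event n V)) :
    ∃ W : Finset (Fin n), #W ≤ t ∧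
      ∀ h', h' <:+ h → #(pending k h') ≤ t → pending k h' ⊆ W := by
  induction h with
  | nil =>
    by_cases hc : #(pending k ([] : List (Event n V))) ≤ t
    · exact ⟨_, hc, fun h' hs _ => by rw [List.suffix_nil.1 hs]⟩
    · exact ⟨∅, by simp, fun h' hs h0 => absurd (List.suffix_nil.1 hs ▸ h0) hc⟩
  | cons e h ih =>
    by_cases hc : #(pending k h) ≤ t
    · obtain ⟨W, hW, hcov⟩ := ih
      refine ⟨W, hW, fun h' hs h0 => ?_⟩
      rcases List.suffix_cons_iff.1 hs with rfl | hs
      · exact (pending_antitone (List.suffix_cons _ _) k).trans (hcov h List.suffix_rfl hc)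
      · exact hcov h' hs h0
    · have hbig : ∀ h', h' <:+ h → ¬ #(pending k h') ≤ t := fun h' hs h0 =>
        hc ((card_le_card (pending_antitone hs k)).trans h0)
      by_cases hc' : #(pending k (e :: h)) ≤ t
      · refine ⟨_, hc', fun h' hs h0 => ?_⟩
        rcases List.suffix_cons_iff.1 hs with rfl | hs
        · exact subset_rfl
        · exact absurd h0 (hbig h' hs)
      · refine ⟨∅, by simp, fun h' hs h0 => ?_⟩
        rcases List.suffix_cons_iff.1 hs with rfl | hs
        · exact absurd h0 hc'
        · exact absurd h0 (hbig h' hs)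

theorem learned_eq (hver : ∀ v, verify v = true ↔ v = vin) {v : V}
    (hv : learned verify h = some v) : v = vin :=
  (hver v).1 (learned_spec hv).1

theorem mem_outputs_iff (hver : ∀ v, verify v = true ↔ v = vin) :
    x ∈ outputs t Q nbr verify p h ↔ n ≠ 1 ∧ ∃ h', h' <:+ h ∧ learned verify h' = some vin ∧
      x ∈ output t Q nbr vin p h' := by
  rw [mem_outputs]
  constructor
  · rintro ⟨h', hs, hx⟩
    obtain ⟨hn, v, hv, hx⟩ := mem_reaction.1 hx
    obtain rfl := learned_eq hver hv
    exact ⟨hn, h', hs, hv, hx⟩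
  · rintro ⟨hn, h', hs, hv, hx⟩
    exact ⟨h', hs, mem_reaction.2 ⟨hn, vin, hv, hx⟩⟩

open Classical in
/-- The parties from whom `p` has requested a certificate when its history is `h`. -/
noncomputable def requestees (t : ℕ) (Q : Finset (Fin n)) (nbr : Fin n → Finset (Fin n)) (vin : V)
    (verify : V → Bool) (p : Fin n) (h : List (Event n V)) : Finset (Fin n) :=
  {c | (c, request vin) ∈ outputs t Q nbr verify p h}

/-- The root accounts for 1. Each of the `Nat.log 2 n + 1` levels contributes the children of a
covering set of at most `t` parties, two for each. -/
theorem card_requestees_le (hver : ∀ v, verify v = true ↔ v = vin) :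
    #(requestees t Q nbr vin verify p h) ≤ 1 + 2 * t * (Nat.log 2 n + 1) := by
  classical
  choose W hW hcov using fun k => exists_pending_cover t k h
  have hsub : requestees t Q nbr vin verify p h ⊆ univ.filter (fun c : Fin n => c.val = 0) ∪
      (range (Nat.log 2 n + 1)).biUnion fun k => (W k).biUnion fun r =>
        univ.filter fun c => IsChild r c := by
    intro c hc
    simp only [requestees, mem_filter, mem_univ, true_and] at hc
    obtain ⟨-, h', hs, -, hx⟩ := (mem_outputs_iff hver).1 hc
    rcases mem_output.1 hx with ⟨-, h2⟩ | ⟨-, -, h2⟩ | ⟨-, -, h2⟩ | ⟨-, h1, -⟩ |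
      ⟨-, -, r, -, h2⟩
    · cases h2
    · cases h2
    · cases h2
    · simp only [requested, mem_filter, mem_univ, true_and] at h1
      rcases h1 with h1 | ⟨r, h1, h2, h3⟩
      · exact mem_union_left _ (by simp [h1])
      · refine mem_union_right _ (mem_biUnion.2 ⟨level r, mem_range.2 (level_lt r), ?_⟩)
        exact mem_biUnion.2 ⟨r, hcov _ h' hs h3 h2, by simp [h1]⟩
    · cases h2
  refine (card_le_card hsub).trans ((card_union_le _ _).trans (add_le_add ?_ ?_))
  · refine card_le_one.2 fun a ha b hb => ?_
    simp only [mem_filter, mem_univ, true_and] at ha hb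
    ext
    omega
  · calc _ ≤ ∑ k ∈ range (Nat.log 2 n + 1), ∑ r ∈ W k, 2 :=
          card_biUnion_le.trans (sum_le_sum fun k _ =>
            card_biUnion_le.trans (sum_le_sum fun r _ => card_isChild_le r))
      _ ≤ ∑ k ∈ range (Nat.log 2 n + 1), 2 * t := by
          refine sum_le_sum fun k _ => ?_
          rw [sum_const, smul_eq_mul, mul_comm]
          exact Nat.mul_le_mul_left _ (hW k)
      _ = _ := by rw [sum_const, card_range, smul_eq_mul, mul_comm]

theorem words_le_two (hver : ∀ v, verify v = true ↔ v = vin)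
    (hx : x ∈ outputs t Q nbr verify p h) : x.2.words ≤ 2 := by
  obtain ⟨-, h', -, -, hx⟩ := (mem_outputs_iff hver).1 hx
  rcases mem_output.1 hx with ⟨-, h2⟩ | ⟨-, -, h2⟩ | ⟨-, -, h2⟩ | ⟨-, -, h2⟩ | ⟨-, -, r, -, h2⟩ <;>
    rw [h2] <;> simp [ack, request, Msg.words]

-- The summands match the kinds of messages. Release and known certificates are monotone in the
-- history, so the present history bounds everything sent earlier; requests are not monotone and are
-- counted by `requestees`.
open Classical in
theorem card_outputs_le (hver : ∀ v, verify v = true ↔ v = vin) :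
    #(outputs t Q nbr verify p h) ≤ 2 + (Nat.log 2 n + 1) +
      (if Released t Q vin p h then #Q else 0) +
      (if p ∈ Q then 1 + 2 * t * (Nat.log 2 n + 1) else 0) +
      (if p ∈ Q then #(nbr p) * #(certified h) else 0) := by
  have hsub : outputs t Q nbr verify p h ⊆
      ({c | IsChild p c} : Finset (Fin n)).image (fun c => (c, .val vin)) ∪
      ({r | Ancestor r p} : Finset (Fin n)).image (fun r => (r, .psig r p ack)) ∪
      (if Released t Q vin p h then Q.image fun q => (q, .agg p ack) else ∅) ∪
      (if p ∈ Q then (requestees t Q nbr vin verify p h).image fun c => (c, request vin) else ∅) ∪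
      (if p ∈ Q then (nbr p ×ˢ certified h).image fun x => (x.1, .agg x.2 ack) else ∅) := by
    rintro ⟨d, m⟩ hx
    obtain ⟨-, h', hs, -, hx'⟩ := (mem_outputs_iff hver).1 hx
    rcases mem_output.1 hx' with ⟨h1, h2⟩ | ⟨h1, -, h2⟩ | ⟨h1, h3, h2⟩ | ⟨h1, -, h2⟩ |
      ⟨h1, h3, r, h4, h2⟩ <;> simp only at h2 <;> subst h2
    · refine mem_union_left _ (mem_union_left _ (mem_union_left _ (mem_union_left _ ?_)))
      exact mem_image.2 ⟨d, by simpa using h1, rfl⟩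
    · refine mem_union_left _ (mem_union_left _ (mem_union_left _ (mem_union_right _ ?_)))
      exact mem_image.2 ⟨d, by simpa using h1, rfl⟩
    · refine mem_union_left _ (mem_union_left _ (mem_union_right _ ?_))
      rw [if_pos (h1.mono hs)]
      exact mem_image.2 ⟨d, h3, rfl⟩
    · refine mem_union_left _ (mem_union_right _ ?_)
      rw [if_pos h1]
      exact mem_image.2 ⟨d, by simpa [requestees] using hx, rfl⟩
    · refine mem_union_right _ ?_
      rw [if_pos h1]
      refine mem_image.2 ⟨(d, r), mem_product.2 ⟨h3, certified_mono hs ?_⟩, rfl⟩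
      simpa [certified] using h4
  refine (card_le_card hsub).trans ?_
  refine (card_union_le _ _).trans (add_le_add ?_ ?_)
  · refine (card_union_le _ _).trans (add_le_add ?_ ?_)
    · refine (card_union_le _ _).trans (add_le_add ?_ ?_)
      · refine (card_union_le _ _).trans (add_le_add ?_ ?_)
        · exact card_image_le.trans (card_isChild_le p)
        · exact card_image_le.trans (card_ancestor_le p)
      · split_ifs
        · exact card_image_le
        · simp
    · split_ifs
      · exact card_image_le.trans (card_requestees_le hver)
      · simp
  · split_ifs
    · exact card_image_le.trans (card_product _ _).le
    · exact card_empty.le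

theorem outputs_eq_empty (hn : n = 1) : outputs t Q nbr verify p h = ∅ := by
  rw [eq_empty_iff_forall_notMem]
  intro x hx
  obtain ⟨h', -, hx⟩ := mem_outputs.1 hx
  exact (mem_reaction.1 hx).1 hn

end Histories

/-! ### What a certificate proves -/

section Unforgeability

variable {n : ℕ} {V : Type u} {Q : Finset (Fin n)} {t : ℕ} {nbr : Fin n → Finset (Fin n)}
  {vin : V} {verify : V → Bool} {c : ℕ → Config n V}

theorem mem_reaction_of_mem_send {p : Fin n} {h : List (Event n V)} {x : Fin n × Msg n V}
    (hx : x ∈ (broadcast V t Q nbr).send p verify h) : x ∈ reaction t Q nbr verify p h := by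
  classical
  cases h with
  | nil => simp [broadcast, outputs] at hx
  | cons e h =>
    obtain ⟨h1, h2⟩ := mem_broadcast_send.1 hx
    rw [outputs, mem_union] at h1
    exact h1.resolve_left h2

/-- A certificate exists only if the root of its subtree has released it or is corrupted. -/
theorem released_of_agg_mem (E : IsExecution (broadcast V t Q nbr) Q t vin verify c)
    (hver : ∀ v, verify v = true ↔ v = vin) {i : ℕ} {q r : Fin n}
    (h : .agg r ack ∈ viewKnowledge ((c i).view q)) :
    r ∈ (c i).corrupted ∨ Released t Q vin r ((c i).view r) := by
  by_contra hno
  push Not at hno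
  -- Unforgeability is applied to the root's own partial signature, with release as the trigger.
  refine ((E.clean (r := r) (p := r) (mem_subtree.2 (Ancestor.refl r)) (Released t Q vin r)
    (fun e h hr => hr.mono (List.suffix_cons e h)) ?_ hno.1 hno.2).2 q _ h).1 rfl
  intro h hclean hrel x hx
  obtain ⟨-, v, hv, hx⟩ := mem_reaction.1 (mem_reaction_of_mem_send hx)
  obtain rfl := learned_eq hver hv
  rcases mem_output.1 hx with ⟨-, h2⟩ | ⟨-, h1, h2⟩ | ⟨h1, -, -⟩ | ⟨-, -, h2⟩ |
    ⟨-, -, r', h1, h2⟩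
  · rw [h2]; trivial
  · rw [h2]; exact ⟨fun h => h1 h.1, trivial⟩
  · exact absurd h1 hrel
  · rw [h2]; exact ⟨trivial, trivial⟩
  · rw [h2]; exact hclean _ h1

/-- A certificate of a subtree exists only if every uncorrupted party in it has the value. -/
theorem learned_of_agg_mem (E : IsExecution (broadcast V t Q nbr) Q t vin verify c) {i : ℕ}
    {p q r : Fin n} (hp : p ∉ (c i).corrupted) (hrp : Ancestor r p)
    (h : .agg r ack ∈ viewKnowledge ((c i).view q)) :
    (learned verify ((c i).view p)).isSome := by
  by_contra hno
  -- Here the trigger is having learned a value: before that, `p` sends nothing at all.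
  refine ((E.clean (r := r) (p := p) (mem_subtree.2 hrp) (fun h => (learned verify h).isSome)
    ?_ ?_ hp hno).2 q _ h).1 rfl
  · intro e h hs
    obtain ⟨v, hv⟩ := Option.isSome_iff_exists.1 hs
    obtain ⟨hver, e', he', hv'⟩ := learned_spec hv
    exact learned_isSome (List.mem_cons_of_mem _ he') hv' hver
  · intro h _ hl x hx
    obtain ⟨-, v, hv, -⟩ := mem_reaction.1 (mem_reaction_of_mem_send hx)
    simp [hv] at hl

end Unforgeability

/-! ### The communication bound -/

section Communication

variable {n : ℕ} {V : Type u} {Q : Finset (Fin n)} {t : ℕ} {nbr : Fin n → Finset (Fin n)}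
  {vin : V} {verify : V → Bool} {c : ℕ → Config n V}

open Classical in
/-- The parties that have released the certificate of their subtree. -/
noncomputable def releasers (t : ℕ) (Q : Finset (Fin n)) (vin : V) (c : Config n V) :
    Finset (Fin n) :=
  {r | Released t Q vin r (c.view r)}

/-- Double counting of requests from uncorrupted quorum nodes to releasers. A releaser has at least
`(3t + 2) / 2` requests, of which at most `t` come from corrupted nodes, while each quorum node
makes few requests. -/
theorem card_releasers_mul_le (E : IsExecution (broadcast V t Q nbr) Q t vin verify c)
    (hver : ∀ v, verify v = true ↔ v = vin) (hQ : #Q = 3 * t + 1) (i : ℕ) :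
    #(releasers t Q vin (c i)) * (t + 1) ≤
      2 * ((3 * t + 1) * (1 + 2 * t * (Nat.log 2 n + 1))) := by
  classical
  let rel : Fin n → Fin n → Prop := fun r q =>
    (r, request vin) ∈ outputs t Q nbr verify q ((c i).view q)
  have h1 : ∀ r ∈ releasers t Q vin (c i), t + 1 ≤ 2 * #(bipartiteAbove rel Q r) := by
    intro r hr
    simp only [releasers, mem_filter, mem_univ, true_and] at hr
    have hsub : requesters Q vin ((c i).view r) \ (c i).corrupted ⊆ bipartiteAbove rel Q r := by
      intro q hq
      simp only [requesters, mem_sdiff, mem_filter] at hq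
      rw [mem_bipartiteAbove]
      exact ⟨hq.1.1, (mem_sent_iff E).1 ((E.recv_mem_view hq.1.2).resolve_right hq.2)⟩
    have h2 := card_le_card hsub
    have h3 := le_card_sdiff (c i).corrupted (requesters Q vin ((c i).view r))
    have h4 := E.card_corrupted_le i
    have h5 := hr.1
    omega
  have h2 := sum_card_bipartiteAbove_eq_sum_card_bipartiteBelow (s := releasers t Q vin (c i))
    (t := Q) rel
  have h3 : ∀ q ∈ Q, #(bipartiteBelow rel (releasers t Q vin (c i)) q) ≤
      1 + 2 * t * (Nat.log 2 n + 1) := by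
    intro q _
    refine (card_le_card fun r hr => ?_).trans (card_requestees_le (t := t) (Q := Q) (nbr := nbr)
      (p := q) (h := (c i).view q) hver)
    rw [mem_bipartiteBelow] at hr
    simpa [requestees] using hr.2
  calc _ = ∑ r ∈ releasers t Q vin (c i), (t + 1) := by rw [sum_const, smul_eq_mul]
    _ ≤ ∑ r ∈ releasers t Q vin (c i), 2 * #(bipartiteAbove rel Q r) := sum_le_sum h1
    _ = 2 * ∑ q ∈ Q, #(bipartiteBelow rel (releasers t Q vin (c i)) q) := by
        rw [← mul_sum, h2]
    _ ≤ 2 * ∑ q ∈ Q, (1 + 2 * t * (Nat.log 2 n + 1)) :=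
        Nat.mul_le_mul_left _ (sum_le_sum h3)
    _ = _ := by rw [sum_const, smul_eq_mul, hQ]

theorem card_certified_le (E : IsExecution (broadcast V t Q nbr) Q t vin verify c)
    (hver : ∀ v, verify v = true ↔ v = vin) (i : ℕ) (q : Fin n) :
    #(certified ((c i).view q)) ≤ #(releasers t Q vin (c i)) + t := by
  classical
  have hsub : certified ((c i).view q) ⊆ releasers t Q vin (c i) ∪ (c i).corrupted := by
    intro r hr
    simp only [certified, mem_filter, mem_univ, true_and] at hr
    rw [mem_union, or_comm]
    exact (released_of_agg_mem E hver hr).imp_right fun h => by simpa [releasers] using h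
  exact (card_le_card hsub).trans ((card_union_le _ _).trans
    (Nat.add_le_add_left (E.card_corrupted_le i) _))

theorem wordsSent_le (E : IsExecution (broadcast V t Q nbr) Q t vin verify c)
    (hver : ∀ v, verify v = true ↔ v = vin) (hQ : #Q = 3 * t + 1) (hE : IsExpander t Q nbr)
    (i : ℕ) : (c i).wordsSent ≤ 13600 * ((n + t ^ 2) * (Nat.log 2 n + 1)) := by
  classical
  set L := Nat.log 2 n + 1 with hL
  set ρ := #(releasers t Q vin (c i)) with hρ
  have hL1 : 1 ≤ L := by omega
  have hn : 3 * t + 1 ≤ n := by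
    rw [← hQ]
    simpa using card_le_univ Q
  have hρ6 : ρ ≤ 6 * (1 + 2 * t * L) := by
    have h := card_releasers_mul_le E hver hQ i
    rw [← hρ, ← hL] at h
    refine Nat.le_of_mul_le_mul_right (c := t + 1) (h.trans ?_) (by omega)
    nlinarith [Nat.zero_le (2 * t * L)]
  have hsum : (c i).wordsSent ≤ 2 * (n * (2 + L) + ρ * (3 * t + 1) +
      (3 * t + 1) * (1 + 2 * t * L) + 96 * (3 * t + 1) * (ρ + t)) := by
    rw [wordsSent_eq E]
    calc ∑ p, ∑ x ∈ outputs t Q nbr verify p ((c i).view p), x.2.words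
        ≤ ∑ p, 2 * #(outputs t Q nbr verify p ((c i).view p)) := by
          refine sum_le_sum fun p _ => ?_
          refine (sum_le_card_nsmul _ _ 2 fun x hx => words_le_two hver hx).trans ?_
          rw [smul_eq_mul, mul_comm]
      _ = 2 * ∑ p, #(outputs t Q nbr verify p ((c i).view p)) := by rw [mul_sum]
      _ ≤ 2 * ∑ p, (2 + L + (if Released t Q vin p ((c i).view p) then #Q else 0) +
            (if p ∈ Q then 1 + 2 * t * L else 0) +
            (if p ∈ Q then #(nbr p) * (ρ + t) else 0)) := by
          refine Nat.mul_le_mul_left _ (sum_le_sum fun p _ => (card_outputs_le hver).trans ?_)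
          refine Nat.add_le_add_left ?_ _
          split_ifs
          · exact Nat.mul_le_mul_left _ (card_certified_le E hver i p)
          · exact le_rfl
      _ = 2 * (n * (2 + L) + ρ * (3 * t + 1) + (3 * t + 1) * (1 + 2 * t * L) +
            (∑ p ∈ Q, #(nbr p)) * (ρ + t)) := by
          have h1 : ∑ p, (if Released t Q vin p ((c i).view p) then #Q else 0) =
              ρ * (3 * t + 1) := by
            rw [← sum_filter, sum_const, smul_eq_mul, hQ, hρ, releasers]
          have h2 : ∑ p, (if p ∈ Q then 1 + 2 * t * L else 0) =
              (3 * t + 1) * (1 + 2 * t * L) := by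
            rw [sum_ite_mem, univ_inter, sum_const, smul_eq_mul, hQ]
          have h3 : ∑ p, (if p ∈ Q then #(nbr p) * (ρ + t) else 0) =
              (∑ p ∈ Q, #(nbr p)) * (ρ + t) := by
            rw [sum_ite_mem, univ_inter, sum_mul]
          rw [sum_add_distrib, sum_add_distrib, sum_add_distrib, h1, h2, h3, sum_const,
            smul_eq_mul, card_univ, Fintype.card_fin]
      _ ≤ _ := by
          have := Nat.mul_le_mul_right (ρ + t) hE.sum_card_le
          omega
  have ht : t ≤ t ^ 2 := Nat.le_self_pow two_ne_zero t
  have hX1 : n ≤ n * L := Nat.le_mul_of_pos_right _ hL1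
  have hX2 : t ^ 2 ≤ t ^ 2 * L := Nat.le_mul_of_pos_right _ hL1
  have hX3 : t * L ≤ t ^ 2 * L := Nat.mul_le_mul_right _ ht
  set X := (n + t ^ 2) * L with hX
  have hX' : X = n * L + t ^ 2 * L := by rw [hX, add_mul]
  have hA : (3 * t + 1) * (1 + 2 * t * L) ≤ 11 * X := by
    have : (3 * t + 1) * (1 + 2 * t * L) = 3 * t + 6 * (t ^ 2 * L) + 1 + 2 * (t * L) := by ring
    omega
  have hB : ρ * (3 * t + 1) ≤ 66 * X := by
    calc ρ * (3 * t + 1) ≤ 6 * (1 + 2 * t * L) * (3 * t + 1) := Nat.mul_le_mul_right _ hρ6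
      _ = 6 * ((3 * t + 1) * (1 + 2 * t * L)) := by ring
      _ ≤ 66 * X := by omega
  have hC : (3 * t + 1) * t ≤ 4 * X := by
    have : (3 * t + 1) * t = 3 * t ^ 2 + t := by ring
    omega
  have hD : n * (2 + L) ≤ 3 * X := by
    have : n * (2 + L) = 2 * n + n * L := by ring
    omega
  have hF : 96 * (3 * t + 1) * (ρ + t) = 96 * (ρ * (3 * t + 1)) + 96 * ((3 * t + 1) * t) := by
    ring
  -- The constant is 13600 = 2 · (3 + 66 + 11 + 96 · (66 + 4)), with the factor 2 for the words per
  -- message.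
  omega

/-- For `n ≥ 2` the 1 is absorbed by doubling the binary logarithm, and `2 / 0.69 < 3`. -/
theorem log_two_add_one_le {n : ℕ} (hn : 2 ≤ n) : ((Nat.log 2 n + 1 : ℕ) : ℝ) ≤ 3 * Real.log n := by
  have h2 : (0.69 : ℝ) < Real.log 2 := by linarith [Real.log_two_gt_d9]
  have h1 : (Nat.log 2 n : ℝ) * Real.log 2 ≤ Real.log n := by
    rw [← Real.log_pow]
    refine Real.log_le_log (by positivity) ?_
    exact_mod_cast Nat.pow_log_le_self 2 (by omega)
  have h3 : 1 ≤ Nat.log 2 n := Nat.log_pos (by norm_num) hn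
  have h4 : (1 : ℝ) ≤ Nat.log 2 n := by exact_mod_cast h3
  push_cast
  nlinarith

theorem communicationAtMost_broadcast (hQ : #Q = 3 * t + 1) (hE : IsExpander t Q nbr) :
    CommunicationAtMost (broadcast V t Q nbr) Q t
      (40800 * (((n : ℝ) + (t : ℝ) ^ 2) * Real.log n)) := by
  intro vin verify hver c E i
  have hn : 3 * t + 1 ≤ n := by
    rw [← hQ]
    simpa using card_le_univ Q
  -- For `n = 1` the claimed bound is zero because `log 1 = 0`. This is why the protocol is silent
  -- in that case.
  by_cases hn1 : n = 1
  · have h0 : (c i).wordsSent = 0 := by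
      rw [wordsSent_eq E]
      exact sum_eq_zero fun p _ => by rw [outputs_eq_empty hn1, sum_empty]
    simp [h0, hn1]
  · have h1 : ((c i).wordsSent : ℝ) ≤ 13600 * (((n : ℝ) + (t : ℝ) ^ 2) *
        ((Nat.log 2 n + 1 : ℕ) : ℝ)) := by
      exact_mod_cast wordsSent_le E hver hQ hE i
    have h2 := log_two_add_one_le (n := n) (by omega)
    calc ((c i).wordsSent : ℝ) ≤ _ := h1
      _ ≤ 13600 * (((n : ℝ) + (t : ℝ) ^ 2) * (3 * Real.log n)) := by gcongr
      _ = _ := by ring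

end Communication

/-! ### Liveness -/

section Liveness

variable {n : ℕ} {V : Type u} {Q : Finset (Fin n)} {t : ℕ} {nbr : Fin n → Finset (Fin n)}
  {vin : V} {verify : V → Bool} {c : ℕ → Config n V}

theorem exists_forall_of_monotone {α : Type*} (s : Finset α) (R : α → ℕ → Prop)
    (hR : ∀ a i j, i ≤ j → R a i → R a j) (h : ∀ a ∈ s, ∃ i, R a i) : ∃ i, ∀ a ∈ s, R a i := by
  have h' : ∀ a, ∃ i, a ∈ s → R a i := fun a => by
    by_cases ha : a ∈ s
    · exact (h a ha).imp fun _ hi _ => hi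
    · exact ⟨0, fun h => absurd h ha⟩
  choose f hf using h'
  exact ⟨s.sup f, fun a ha => hR a _ _ (le_sup ha) (hf a ha)⟩

theorem learned_of_mem (hver : ∀ v, verify v = true ↔ v = vin) {h : List (Event n V)}
    {e : Event n V} (he : e ∈ h) (hv : e.value? = some vin) : learned verify h = some vin := by
  obtain ⟨v, hv'⟩ := Option.isSome_iff_exists.1 (learned_isSome he hv ((hver vin).2 rfl))
  rw [hv', learned_eq hver hv']

theorem learned_mono (hver : ∀ v, verify v = true ↔ v = vin) {h h' : List (Event n V)}
    (hs : h <:+ h') (hl : learned verify h = some vin) : learned verify h' = some vin := by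
  obtain ⟨-, e, he, hv⟩ := learned_spec hl
  exact learned_of_mem hver (hs.mem he) hv

theorem learned_of_mem_quorum {P : Protocol n V} (E : IsExecution P Q t vin verify c)
    (hver : ∀ v, verify v = true ↔ v = vin) {q : Fin n} (hq : q ∈ Q) {i : ℕ}
    (h : (c i).view q ≠ []) : learned verify ((c i).view q) = some vin :=
  learned_of_mem hver (E.start_mem_view hq i h) rfl

/-- What an honest party should have sent to an honest party eventually arrives. -/
theorem exists_recv_of_mem_output (E : IsExecution (broadcast V t Q nbr) Q t vin verify c)
    (hver : ∀ v, verify v = true ↔ v = vin) (hn : n ≠ 1) {p q : Fin n} {m : Msg n V} {i : ℕ}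
    (hp : Honest c p) (hq : Honest c q) (hl : learned verify ((c i).view p) = some vin)
    (hm : (q, m) ∈ output t Q nbr vin p ((c i).view p)) : ∃ j, .recv p m ∈ (c j).view q :=
  E.exists_recv ((mem_sent_iff E).2 ((mem_outputs_iff hver).2
    ⟨hn, _, List.suffix_rfl, hl, hm⟩)) hp hq

/-- In a subtree of honest parties whose root has the value everybody gets the value. -/
theorem exists_learned_of_ancestor (E : IsExecution (broadcast V t Q nbr) Q t vin verify c)
    (hver : ∀ v, verify v = true ↔ v = vin) (hn : n ≠ 1) {r : Fin n}
    (hr : ∀ d, Ancestor r d → Honest c d) (hl : ∃ i, learned verify ((c i).view r) = some vin)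
    (d : Fin n) (hd : Ancestor r d) : ∃ i, learned verify ((c i).view d) = some vin := by
  induction d using WellFoundedLT.induction with
  | ind d ih =>
    rcases hd.eq_or_exists_isChild with rfl | ⟨b, hb, hrb⟩
    · exact hl
    · obtain ⟨i, hi⟩ := ih b hb.lt hrb
      obtain ⟨j, hj⟩ := exists_recv_of_mem_output E hver hn (hr b hrb) (hr d hd) hi
        (mem_output.2 (.inl ⟨hb, rfl⟩))
      exact ⟨j, learned_of_mem hver hj rfl⟩

/-- A subtree of honest parties is eventually certified to every honest quorum node if sufficiently
many quorum nodes request that. -/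
theorem exists_agg_of_requests (E : IsExecution (broadcast V t Q nbr) Q t vin verify c)
    (hver : ∀ v, verify v = true ↔ v = vin) (hn : n ≠ 1) {r : Fin n}
    (hr : ∀ d, Ancestor r d → Honest c d) {H : Finset (Fin n)} (hHQ : H ⊆ Q)
    (hH : 3 * t + 2 ≤ 2 * #H) (hreq : ∀ q ∈ H, ∃ i, .recv q (request vin) ∈ (c i).view r)
    {q : Fin n} (hq : q ∈ Q) (hqh : Honest c q) :
    ∃ i, .agg r ack ∈ viewKnowledge ((c i).view q) := by
  classical
  have hrr := hr r (Ancestor.refl r)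
  have hne : H.Nonempty := card_pos.1 (by omega)
  obtain ⟨i1, h1⟩ := exists_forall_of_monotone H
    (fun q i => .recv q (request vin) ∈ (c i).view r)
    (fun _ _ _ hij h => E.mem_view_of_le hij h) hreq
  obtain ⟨x, hx⟩ := hne
  -- A request carries the value, so the root of the subtree need not have received it from its
  -- parent.
  have hl1 : learned verify ((c i1).view r) = some vin := learned_of_mem hver (h1 x hx) rfl
  obtain ⟨i2, h2⟩ := exists_forall_of_monotone (univ.filter fun d => Ancestor r d ∧ d ≠ r)
    (fun d i => .psig r d ack ∈ viewKnowledge ((c i).view r))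
    (fun _ _ _ hij h => viewKnowledge_mono (E.view_suffix hij r) h) fun d hd => by
      obtain ⟨hd1, hd2⟩ := (mem_filter.1 hd).2
      obtain ⟨i, hi⟩ := exists_learned_of_ancestor E hver hn hr ⟨i1, hl1⟩ d hd1
      obtain ⟨j, hj⟩ := exists_recv_of_mem_output (m := .psig r d ack) E hver hn (hr d hd1) hrr
        hi (mem_output.2 (.inr (.inl ⟨hd1, hd2.symm, rfl⟩)))
      exact ⟨j, .inr ⟨d, hj⟩⟩
  have hrel : Released t Q vin r ((c (max i1 i2)).view r) := by
    refine ⟨hH.trans (Nat.mul_le_mul_left _ (card_le_card fun q hq => ?_)), fun d hd hdr => ?_⟩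
    · exact mem_filter.2 ⟨hHQ hq, E.mem_view_of_le (le_max_left _ _) (h1 q hq)⟩
    · exact viewKnowledge_mono (E.view_suffix (le_max_right _ _) r)
        (h2 d (mem_filter.2 ⟨mem_univ _, hd, hdr⟩))
  obtain ⟨j, hj⟩ := exists_recv_of_mem_output E hver hn hrr hqh
    (learned_mono hver (E.view_suffix (le_max_left i1 i2) r) hl1)
    (mem_output.2 (.inr (.inr (.inl ⟨hrel, hq, rfl⟩))))
  exact ⟨j, .inr ⟨r, hj⟩⟩

/-- The quorum nodes in `H` never receive a certificate that covers `r`. -/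
def Uncovered (c : ℕ → Config n V) (H : Finset (Fin n)) (r : Fin n) : Prop :=
  ∀ a, Ancestor a r → ∀ q ∈ H, ∀ i, .agg a ack ∉ viewKnowledge ((c i).view q)

/-- An uncovered honest party is requested by the quorum nodes in `H` once few parties of the
previous level are pending. -/
theorem exists_request_of_uncovered (E : IsExecution (broadcast V t Q nbr) Q t vin verify c)
    (hver : ∀ v, verify v = true ↔ v = vin) (hn : n ≠ 1) {r : Fin n} (hr : Honest c r)
    {H : Finset (Fin n)} (hHQ : H ⊆ Q) (hH : ∀ q ∈ H, Honest c q) (hu : Uncovered c H r)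
    (hlev : ∀ k < level r, ∀ q ∈ H, ∃ i, #(pending k ((c i).view q)) ≤ t) {q : Fin n}
    (hq : q ∈ H) : ∃ i, .recv q (request vin) ∈ (c i).view r := by
  obtain ⟨i0, hi0⟩ := E.starts q (hH q hq)
  have hl := learned_of_mem_quorum E hver (hHQ hq) hi0
  suffices ∃ i, i0 ≤ i ∧ r ∈ requested t ((c i).view q) by
    obtain ⟨i, hi, hreq⟩ := this
    exact exists_recv_of_mem_output E hver hn (hH q hq) hr
      (learned_mono hver (E.view_suffix hi q) hl)
      (mem_output.2 (.inr (.inr (.inr (.inl ⟨hHQ hq, hreq, rfl⟩)))))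
  by_cases h0 : r.val = 0
  · exact ⟨i0, le_rfl, by simp [requested, h0]⟩
  · obtain ⟨b, hb⟩ := exists_isChild h0
    obtain ⟨i, hi⟩ := hlev (level b) (by rw [hb.level_eq]; omega) q hq
    refine ⟨max i0 i, le_max_left _ _, ?_⟩
    simp only [requested, mem_filter, mem_univ, true_and]
    refine .inr ⟨b, hb, ?_, (card_le_card (pending_antitone
      (E.view_suffix (le_max_right i0 i) q) _)).trans hi⟩
    simp only [pending, mem_filter, mem_univ, true_and]
    -- A certificate covering the parent `b` would also cover `r`, so `b` stays pending forever.
    exact fun a ha => hu a (ha.trans hb.ancestor) q hq _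

/-- On each level at most `t` parties stay pending for the quorum nodes of a core. -/
theorem exists_card_pending_le (E : IsExecution (broadcast V t Q nbr) Q t vin verify c)
    (hver : ∀ v, verify v = true ↔ v = vin) (hn : n ≠ 1) {H : Finset (Fin n)} (hHQ : H ⊆ Q)
    (hH : ∀ q ∈ H, Honest c q) (hcard : 3 * t + 2 ≤ 2 * #H)
    (hcore : ∀ r, (∃ x ∈ H, ∃ i, .agg r ack ∈ viewKnowledge ((c i).view x)) →
      ∀ x ∈ H, ∃ i, .agg r ack ∈ viewKnowledge ((c i).view x)) (k : ℕ) :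
    ∀ q ∈ H, ∃ i, #(pending k ((c i).view q)) ≤ t := by
  classical
  induction k using Nat.strong_induction_on with
  | _ k ih =>
    intro q hq
    have hbad : ∀ r, level r = k → Uncovered c H r → ∃ d, Ancestor r d ∧ ¬ Honest c d := by
      rintro r rfl hu
      by_contra! hall
      have hreq : ∀ x ∈ H, ∃ i, .recv x (request vin) ∈ (c i).view r := fun x hx =>
        exists_request_of_uncovered E hver hn (hall r (Ancestor.refl r)) hHQ hH hu ih hx
      obtain ⟨i, hi⟩ := exists_agg_of_requests E hver hn hall hHQ hcard hreq (hHQ hq) (hH q hq)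
      exact hu r (Ancestor.refl r) q hq i hi
    have hdead : #{r | level r = k ∧ Uncovered c H r} ≤ t := by
      have h' : ∀ r, ∃ d, level r = k → Uncovered c H r → Ancestor r d ∧ ¬ Honest c d := by
        intro r
        by_cases h : level r = k ∧ Uncovered c H r
        · exact (hbad r h.1 h.2).imp fun d hd _ _ => hd
        · exact ⟨r, fun h1 h2 => absurd ⟨h1, h2⟩ h⟩
      -- Each uncovered party of level `k` is mapped to a corrupted descendant. The map is injective
      -- because subtrees on one level are disjoint.
      choose f hf using h'
      refine le_trans (card_le_card_of_injOn f (fun r hr => ?_) ?_) E.card_not_honest_le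
      · rw [mem_coe, mem_filter] at hr ⊢
        exact ⟨mem_univ _, (hf r hr.2.1 hr.2.2).2⟩
      · intro a ha b hb hab
        rw [mem_coe, mem_filter] at ha hb
        refine (hf a ha.2.1 ha.2.2).1.eq_of_level_eq ?_ (ha.2.1.trans hb.2.1.symm)
        rw [hab]
        exact (hf b hb.2.1 hb.2.2).1
    -- For every other party some core node gets a covering certificate, which then reaches `q` as
    -- well. Finitely many such arrivals have all happened by a common time.
    obtain ⟨i, hi⟩ := exists_forall_of_monotone (univ.filter fun r => ¬ Uncovered c H r)
      (fun r i => ∃ a, Ancestor a r ∧ .agg a ack ∈ viewKnowledge ((c i).view q))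
      (fun _ _ _ hij ⟨a, ha, h⟩ => ⟨a, ha, viewKnowledge_mono (E.view_suffix hij q) h⟩)
      fun r hr => by
        have hr := (mem_filter.1 hr).2
        unfold Uncovered at hr
        push Not at hr
        obtain ⟨a, ha, x, hx, j, hj⟩ := hr
        obtain ⟨i, hi⟩ := hcore a ⟨x, hx, j, hj⟩ q hq
        exact ⟨i, a, ha, hi⟩
    refine ⟨i, (card_le_card fun r hr => ?_).trans hdead⟩
    simp only [pending, mem_filter, mem_univ, true_and] at hr ⊢
    refine ⟨hr.1, ?_⟩
    by_contra hu
    obtain ⟨a, ha, h⟩ := hi r (mem_filter.2 ⟨mem_univ _, hu⟩)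
    exact hr.2 a ha h

/-- An honest party that never learns the value is never covered, so the core eventually requests
it, and the request reveals the value. Safety is immediate, since only verified values are decided.
-/
theorem solves_broadcast (hQ : #Q = 3 * t + 1) (hE : IsExpander t Q nbr) :
    Solves (broadcast V t Q nbr) Q t := by
  classical
  intro vin verify hver c E
  refine ⟨fun p hp => ?_, fun i p v _ hv => learned_eq hver hv⟩
  change ∃ i, learned verify ((c i).view p) = some vin
  by_contra hno
  have hpQ : p ∉ Q := fun hpQ => by
    obtain ⟨i, hi⟩ := E.starts p hp
    exact hno ⟨i, learned_of_mem_quorum E hver hpQ hi⟩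
  have hn : n ≠ 1 := by
    rintro rfl
    obtain ⟨q, hq⟩ : Q.Nonempty := card_pos.1 (by omega)
    exact hpQ (Subsingleton.elim q p ▸ hq)
  have hG : 2 * t + 1 ≤ #(Q.filter (Honest c)) := by
    have h1 := card_filter_add_card_filter_not (s := Q) (Honest c)
    have h2 : #(Q.filter fun q => ¬ Honest c q) ≤ t :=
      (card_le_card (filter_subset_filter _ (subset_univ Q))).trans E.card_not_honest_le
    omega
  obtain ⟨H, hHG, hcard, hcore⟩ := hE.exists_core _ (filter_subset _ _) hG
  have hHQ : H ⊆ Q := hHG.trans (filter_subset _ _)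
  have hH : ∀ q ∈ H, Honest c q := fun q hq => (mem_filter.1 (hHG hq)).2
  have hcore' : ∀ r, (∃ x ∈ H, ∃ i, .agg r ack ∈ viewKnowledge ((c i).view x)) →
      ∀ x ∈ H, ∃ i, .agg r ack ∈ viewKnowledge ((c i).view x) := by
    intro r
    -- Forwarding makes the set of nodes that ever hold a given certificate closed under adjacency
    -- among honest quorum nodes, as the core property requires.
    refine hcore {x | ∃ i, .agg r ack ∈ viewKnowledge ((c i).view x)} ?_
    rintro x ⟨i, hi⟩ hx y hxy hy
    rw [mem_filter] at hx hy
    have hne : (c i).view x ≠ [] := fun h0 => by simp [h0, viewKnowledge] at hi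
    obtain ⟨j, hj⟩ := exists_recv_of_mem_output E hver hn hx.2 hy.2
      (learned_of_mem_quorum E hver hx.1 hne)
      (mem_output.2 (.inr (.inr (.inr (.inr ⟨hx.1, hxy, r, hi, rfl⟩)))))
    exact ⟨j, .inr ⟨x, hj⟩⟩
  have hu : Uncovered c H p := by
    intro a ha q _ i h
    obtain ⟨v, hv⟩ := Option.isSome_iff_exists.1 (learned_of_agg_mem E (hp i) ha h)
    exact hno ⟨i, by rw [hv, learned_eq hver hv]⟩
  obtain ⟨q, hq⟩ : H.Nonempty := card_pos.1 (by omega)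
  obtain ⟨i, hi⟩ := exists_request_of_uncovered E hver hn hp hHQ hH hu
    (fun k _ => exists_card_pending_le E hver hn hHQ hH hcard hcore' k) hq
  exact hno ⟨i, learned_of_mem hver hi rfl⟩

end Liveness

end QAB

theorem mainTheorem6 :
    ∃ C : ℝ, 0 < C ∧
      ∀ (n t : ℕ) (Q : Finset (Fin n)), Q.card = 3 * t + 1 →
        ∀ V : Type u, ∃ P : QAB.Protocol n V,
          QAB.Solves P Q t ∧
          QAB.CommunicationAtMost P Q t (C * (((n : ℝ) + (t : ℝ) ^ 2) * Real.log n)) := by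
  refine ⟨40800, by norm_num, fun n t Q hQ V => ?_⟩
  obtain ⟨nbr, hE⟩ := QAB.exists_isExpander t Q hQ
  exact ⟨QAB.broadcast V t Q nbr, QAB.solves_broadcast hQ hE,
    QAB.communicationAtMost_broadcast hQ hE⟩
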